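/- Let $G=(V,D,B)$ be an acyclic mixed graph on a finite set $V$, with directed edges $u\to v\in D$ and symmetric bidirected edges $u\leftrightarrow v\in B$, without self-loops. Let $\theta=\lambda\cup\omega$ be the indeterminates $\lambda_{uv}$ ($u\to v\in D$) and $\omega_{uv}=\omega_{vu}$ ($u\leftrightarrow v\in B$ or $u=v$), let $\sigma_{uv}=\sigma_{vu}$ ($u,v\in V$) be further indeterminates, let $\Lambda$, $\Omega$, $\Sigma$ be the corresponding symbolic matrices (with zeros at non-edges), and let $\mathcal I\subseteq\mathbb R[\theta,\sigma]$ be the ideal generated by the entries of $\Sigma-(I-\Lambda)^{-\top}\Omega(I-\Lambda)^{-1}$. For a total order $\prec$ on $\theta$, an identifying polynomial for $q\in\theta$ is a $g_q\in\mathcal I$ of the form $g_q=q\,a-b$ with $a,b\in\mathbb R[\theta_{\mathrm{id}},\sigma]$ and $a\notin\mathcal I$, where $\theta_{\mathrm{id}}\subseteq\{t\in\theta: t\prec q\}$. The order $\prec$ is identifying if every $q\in\theta$ has an identifying polynomial. *Instrumental Cutset criterion.* Let $K\subseteq D$ be a set of already identified edges. The auxiliary flow graph $G_K$ has nodes $v,v^*,v'$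 ($v\in V$) and edges $v\to v^*$ and $v^*\to v'$ for $v\in V$; $v\to u$ for $u\to v\in K$; $v^*\to u$ for $u\to v\in D\setminus K$; $u^*\to v'$ for $u\leftrightarrow v\in B$; and $u'\to v'$ for $u\to v\in D$. An edge $x\to y\in D\setminus K$ satisfies the criterion relative to $K$ if there are a set $S=\{s_1,\dots,s_k\}$ of $k$ distinct elements of $V\cup\{v^*:v\in V\}$ and a set $\{t_1,\dots,t_k\}$ of $k$ distinct parents of $y$ with $t_{j_0}=x$ for some $j_0$ such that (i) $G_K$ contains $k$ pairwise node-disjoint directed paths from $S$ to $\{t_1',\dots,t_k'\}$, and (ii) after removing from $G_K$ the edge $x'\to y'$ and all edges $p'\to y'$ with $p\to y\in K$, there are no $k$ pairwise node-disjoint directed paths from $S$ to $(\{t_1',\dots,t_k'\}\setminus\{x'\})\cup\{y'\}$. The identified edges are defined recursively: an edge is identified if it satisfies the criterion relative to some set $K$ of identified edges. $G$ is IC-identifiable if all its directed edges are identified in this way. **Proposition.** Let the acyclic mixed graph $G$ be IC-identifiable, and let $s\ge 1$ be such that $|\mathrm{pa}(v)|\le s$ for all $v\in V$. Then there are an identifying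 order $\prec$ on $\theta$ and a set of identifying polynomials $P_\prec=\{g_q:q\in\theta\}$ with respect to $\prec$ such that $\deg(g_q)\le 2s+1$ for all $q\in\theta$. Moreover, these can be chosen such that for every $x\to y\in D$ there are a set $K\subseteq\{u\to v\in D:\lambda_{uv}\prec\lambda_{xy}\}$ and $s_1,\dots,s_k$, $t_1,\dots,t_k$, $j_0$ witnessing the criterion for $x\to y$ relative to $K$ with $$g_{\lambda_{xy}}=\lambda_{xy}\det(A)-\det(A_{j_0}).$$ Here $\Lambda^{\mathrm{id}}$ has the entries of $\Lambda$ at the edges in $K$ and zeros elsewhere; $A$ is the $k\times k$ matrix with $A_{ij}=\Sigma_{v t_j}$ if $s_i=v\in V$ and $A_{ij}=[(I-\Lambda^{\mathrm{id}})^\top\Sigma]_{v t_j}$ if $s_i=v^*$; and $A_{j_0}$ is $A$ with its $j_0$-th column replaced by the vector $b$ with $b_i=[\Sigma(I-\Lambda^{\mathrm{id}})]_{vy}$ if $s_i=v\in V$ and $b_i=[(I-\Lambda^{\mathrm{id}})^\top\Sigma(I-\Lambda^{\mathrm{id}})]_{vy}$ if $s_i=v^*$. -/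

import Mathlib

/-- A mixed graph on the node set `V`: directed edges `v → w` and (symmetric) bidirected edges
`v ↔ w`, neither part having self-loops. -/
structure MixedGraph (V : Type*) where
  /-- `dir v w` says that `v → w` is a directed edge. -/
  dir : V → V → Prop
  dir_irrefl : ∀ v, ¬ dir v v
  /-- `bi.Adj v w` says that `v ↔ w` is a bidirected edge. -/
  bi : SimpleGraph V

namespace MixedGraph

variable {V : Type*}

/-- The directed part has no directed cycle. -/
def IsAcyclic (G : MixedGraph V) : Prop :=
  ∀ v, ¬ Relation.TransGen G.dir v v

/-- The set `pa(v)` of parents of `v`. -/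
def parents (G : MixedGraph V) (v : V) : Set V :=
  {u | G.dir u v}

/-- The directed edges, that is, the indices of the indeterminates `λ_{uv}`. -/
abbrev DirEdge (G : MixedGraph V) : Type _ :=
  {e : V × V // G.dir e.1 e.2}

/-- The indices of the indeterminates `ω`: the unordered pairs `{u, v}` with `u ↔ v`, and the
diagonal pairs `{v, v}`. -/
abbrev BiIndex (G : MixedGraph V) : Type _ :=
  {e : Sym2 V // e.IsDiag ∨ e ∈ G.bi.edgeSet}

/-- The indices of the parameters `θ = λ ∪ ω`. -/
abbrev Param (G : MixedGraph V) : Type _ :=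
  G.DirEdge ⊕ G.BiIndex

/-- The ring `ℝ[θ]`. -/
abbrev ParamRing (G : MixedGraph V) : Type _ :=
  MvPolynomial G.Param ℝ

/-- The ring `ℝ[θ, σ]`; the indeterminate `σ_{uv} = σ_{vu}` is indexed by the unordered pair. -/
abbrev FullRing (G : MixedGraph V) : Type _ :=
  MvPolynomial (G.Param ⊕ Sym2 V) ℝ

open Classical in
/-- The symbolic matrix `Λ` over `ℝ[θ]`. -/
noncomputable def lambdaMatrix (G : MixedGraph V) : Matrix V V G.ParamRing :=
  fun u v => if h : G.dir u v then MvPolynomial.X (Sum.inl ⟨(u, v), h⟩) else 0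

open Classical in
/-- The symbolic symmetric matrix `Ω` over `ℝ[θ]`. -/
noncomputable def omegaMatrix (G : MixedGraph V) : Matrix V V G.ParamRing :=
  fun u v =>
    if h : s(u, v).IsDiag ∨ s(u, v) ∈ G.bi.edgeSet then MvPolynomial.X (Sum.inr ⟨s(u, v), h⟩)
    else 0

/-- The matrix `(I - Λ)⁻ᵀ Ω (I - Λ)⁻¹`, whose `(u, v)` entry is `τ_G(σ_{uv})`. For acyclic `G` the
matrix `I - Λ` is invertible over `ℝ[θ]`. -/
noncomputable def covariance [Fintype V] [DecidableEq V] (G : MixedGraph V) :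
    Matrix V V G.ParamRing :=
  ((1 - G.lambdaMatrix)⁻¹).transpose * G.omegaMatrix * (1 - G.lambdaMatrix)⁻¹

/-- The symbolic symmetric matrix `Σ = (σ_{uv})` over `ℝ[θ, σ]`. -/
noncomputable def sigmaMatrix (G : MixedGraph V) : Matrix V V G.FullRing :=
  fun u v => MvPolynomial.X (Sum.inr s(u, v))

/-- The ideal `ℐ ⊆ ℝ[θ, σ]` of the graph of the parametrization, generated by the polynomials
`σ_{uv} - τ_G(σ_{uv})`. -/
noncomputable def graphIdeal [Fintype V] [DecidableEq V] (G : MixedGraph V) : Ideal G.FullRing :=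
  Ideal.span (Set.range fun e : V × V =>
    G.sigmaMatrix e.1 e.2 - MvPolynomial.rename Sum.inl (G.covariance e.1 e.2))

/-- The subring `ℝ[θ_id, σ]` of `ℝ[θ, σ]`. -/
noncomputable def knownRing (G : MixedGraph V) (known : Set G.Param) :
    Subalgebra ℝ G.FullRing :=
  MvPolynomial.supported ℝ (Sum.inl '' known ∪ Set.range Sum.inr)

/-- `g` is an identifying polynomial for the parameter `q` with respect to the total order `r`. -/
def IsIdentifyingPolynomial [Fintype V] [DecidableEq V] (G : MixedGraph V)
    (r : LinearOrder G.Param) (q : G.Param) (g : G.FullRing) : Prop :=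
  g ∈ G.graphIdeal ∧
    ∃ known : Set G.Param, (∀ t ∈ known, r.lt t q) ∧
      ∃ a ∈ G.knownRing known, ∃ b ∈ G.knownRing known,
        a ∉ G.graphIdeal ∧ g = MvPolynomial.X (Sum.inl q) * a - b

/-- A total order on the parameters is identifying if every parameter has an identifying
polynomial with respect to it. -/
def IsIdentifyingOrder [Fintype V] [DecidableEq V] (G : MixedGraph V)
    (r : LinearOrder G.Param) : Prop :=
  ∀ q, ∃ g, G.IsIdentifyingPolynomial r q g

/-! ### The Instrumental Cutset criterion -/

/-- The nodes of the auxiliary flow graph: for each `v`, the observed variable `v` (`obs v`), the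
auxiliary variable `v*` (`aux v`), obtained from `v` by subtracting the contribution of the parents
whose edge into `v` is already identified, and the sink copy `v'` (`sink v`). -/
inductive FlowNode (V : Type*) where
  | obs (v : V) : FlowNode V
  | aux (v : V) : FlowNode V
  | sink (v : V) : FlowNode V

/-- The edges of the auxiliary flow graph, where `K` is the set of directed edges that are already
identified. -/
inductive AuxFlowEdge (G : MixedGraph V) (K : Set G.DirEdge) : FlowNode V → FlowNode V → Prop
  | known {u v : V} (h : G.dir u v) (hK : ⟨(u, v), h⟩ ∈ K) :
      AuxFlowEdge G K (.obs v) (.obs u)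
  | unknown {u v : V} (h : G.dir u v) (hK : ⟨(u, v), h⟩ ∉ K) :
      AuxFlowEdge G K (.aux v) (.obs u)
  | obs_aux (v : V) : AuxFlowEdge G K (.obs v) (.aux v)
  | aux_sink (v : V) : AuxFlowEdge G K (.aux v) (.sink v)
  | bidirected {u v : V} (h : G.bi.Adj u v) : AuxFlowEdge G K (.aux u) (.sink v)
  | sink_sink {u v : V} (h : G.dir u v) : AuxFlowEdge G K (.sink u) (.sink v)

/-- The auxiliary flow graph with the edges `p' → y'` removed for which `p → y` is the edge `e`
(here `y` is the head of `e`) or is already identified. -/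
def ReducedFlowEdge (G : MixedGraph V) (K : Set G.DirEdge) (e : G.DirEdge) (a b : FlowNode V) :
    Prop :=
  G.AuxFlowEdge K a b ∧
    ¬ ∃ f : G.DirEdge, (f = e ∨ f ∈ K) ∧ f.1.2 = e.1.2 ∧ a = .sink f.1.1 ∧ b = .sink f.1.2

/-- There is a flow of size `k` (all node capacities being one) from the `k` nodes `src` to the
`k` nodes `tgt`: pairwise node-disjoint directed paths joining `src` to `tgt` bijectively. -/
def HasFullFlow {N : Type*} (edge : N → N → Prop) {k : ℕ} (src tgt : Fin k → N) : Prop :=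
  ∃ (π : Equiv.Perm (Fin k)) (path : Fin k → List N),
    (∀ i, (path i).IsChain edge ∧ (path i).head? = some (src i) ∧
      (path i).getLast? = some (tgt (π i))) ∧
    ∀ i j, i ≠ j → (path i).Disjoint (path j)

/-- A source for the instrumental cutset criterion: an observed variable `v` or an auxiliary
variable `v*`. -/
inductive Source (V : Type*) where
  | obs (v : V) : Source V
  | aux (v : V) : Source V

/-- The source as a node of the auxiliary flow graph. -/
def Source.node : Source V → FlowNode V
  | .obs v => .obs v
  | .aux v => .aux v

/-- An enumeration `s₁, …, s_k` of a set of sources, an enumeration `t₁, …, t_k` of a set of nodes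
and a distinguished index `col`. -/
structure CutsetData (V : Type*) where
  k : ℕ
  src : Fin k → Source V
  tgt : Fin k → V
  col : Fin k

/-- The instrumental cutset criterion for the directed edge `e = (x → y)`, given the set `K` of
already identified directed edges: the `sᵢ` are distinct, the `tⱼ` are distinct parents of `y` with
`t_col = x`, there is a flow of size `k` from `{s₁, …, s_k}` to `{t₁', …, t_k'}` in the auxiliary
flow graph, and there is none from `{s₁, …, s_k}` to `({t₁', …, t_k'} ∖ {x'}) ∪ {y'}` in the
auxiliary flow graph without the edges into `y'` that correspond to `e` or to an element of `K`. -/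
structure IsInstrumentalCutset (G : MixedGraph V) (K : Set G.DirEdge) (e : G.DirEdge)
    (c : CutsetData V) : Prop where
  not_known : e ∉ K
  src_injective : Function.Injective c.src
  tgt_injective : Function.Injective c.tgt
  tgt_parent : ∀ j, c.tgt j ∈ G.parents e.1.2
  tgt_col : c.tgt c.col = e.1.1
  flow : HasFullFlow (G.AuxFlowEdge K)
    (fun i => (c.src i).node) (fun j => FlowNode.sink (c.tgt j))
  no_flow : ¬ HasFullFlow (G.ReducedFlowEdge K e)
    (fun i => (c.src i).node) (fun j => FlowNode.sink (Function.update c.tgt c.col e.1.2 j))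

/-- The directed edges that are identified by recursive application of the instrumental cutset
criterion. -/
inductive ICIdentified (G : MixedGraph V) : G.DirEdge → Prop
  | step (K : Set G.DirEdge) (e : G.DirEdge) (c : CutsetData V)
      (hK : ∀ f ∈ K, ICIdentified G f) (hc : G.IsInstrumentalCutset K e c) : ICIdentified G e

/-- `G` is IC-identifiable: every directed edge is identified by recursive application of the
instrumental cutset criterion. -/
def IsICIdentifiable (G : MixedGraph V) : Prop :=
  ∀ e, G.ICIdentified e

/-! ### The associated determinantal polynomials -/

open Classical in
/-- The matrix `Λ^id` over `ℝ[θ, σ]`: the entries of `Λ` at the edges in `K`, and zero elsewhere. -/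
noncomputable def knownLambda (G : MixedGraph V) (K : Set G.DirEdge) : Matrix V V G.FullRing :=
  fun u v =>
    if h : ∃ h : G.dir u v, (⟨(u, v), h⟩ : G.DirEdge) ∈ K then
      MvPolynomial.X (Sum.inl (Sum.inl ⟨(u, v), h.choose⟩))
    else 0

/-- The matrix `A`, with entry `Σ_{v t}` for a source `v` and `[(I - Λ^id)ᵀ Σ]_{v t}` for a source
`v*`, where `t = tⱼ`. -/
noncomputable def cutsetMatrix [Fintype V] [DecidableEq V] (G : MixedGraph V) (K : Set G.DirEdge)
    (c : CutsetData V) : Matrix (Fin c.k) (Fin c.k) G.FullRing :=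
  fun i j =>
    match c.src i with
    | .obs v => G.sigmaMatrix v (c.tgt j)
    | .aux v => ((1 - G.knownLambda K).transpose * G.sigmaMatrix) v (c.tgt j)

/-- The vector `b`, with entry `[Σ (I - Λ^id)]_{v y}` for a source `v` and
`[(I - Λ^id)ᵀ Σ (I - Λ^id)]_{v y}` for a source `v*`. -/
noncomputable def cutsetVector [Fintype V] [DecidableEq V] (G : MixedGraph V) (K : Set G.DirEdge)
    (y : V) (c : CutsetData V) : Fin c.k → G.FullRing :=
  fun i =>
    match c.src i with
    | .obs v => (G.sigmaMatrix * (1 - G.knownLambda K)) v y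
    | .aux v =>
      ((1 - G.knownLambda K).transpose * G.sigmaMatrix * (1 - G.knownLambda K)) v y

/-- The polynomial `λ_{xy} det(A) - det(A_col)` for `e = (x → y)`, where `A_col` is `A` with the
column `col` replaced by `b`. -/
noncomputable def cutsetPolynomial [Fintype V] [DecidableEq V] (G : MixedGraph V)
    (K : Set G.DirEdge) (e : G.DirEdge) (c : CutsetData V) : G.FullRing :=
  MvPolynomial.X (Sum.inl (Sum.inl e)) * (G.cutsetMatrix K c).det -
    ((G.cutsetMatrix K c).updateCol c.col (G.cutsetVector K e.1.2 c)).det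

end MixedGraph

/-! Substituting $(I-\Lambda)^{-\top}\Omega(I-\Lambda)^{-1}$ for $\Sigma$ is a homomorphism
`covarianceHom` with kernel $\mathcal I$ (`mem_graphIdeal_iff`), so membership in $\mathcal I$
becomes vanishing in $\mathbb R[\theta]$. Under it $A$ becomes a submatrix of $M$ = `flowCovariance
K`, the covariances of the variables $v$ and $v^*$ with $V$. Flows enter through a determinant of
Lindström–Gessel–Viennot type. For an acyclic graph with weight matrix $W$, border $1-W$ with unit
columns at the targets and unit rows at the sources. Up to sign the determinant is that of the path
generating functions (`det_borderedMatrix`), and the permutations that can contribute to its Leibniz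
expansion encode systems of disjoint paths. A nonzero determinant thus yields a flow; conversely, a
flow yields a nonzero determinant once no two terms can cancel. The cutset polynomial vanishes:
deleting $\lambda_{xy}$ and the known edges into $y$ changes $\Lambda$ by a matrix of rank one.
Multiplying $M$ by $(I-\Lambda)(I-\Lambda_{\mathrm{red}})^{-1}$ therefore fixes its columns at the
parents of $y$ and makes the column at $y$ equal to $b$ minus $\lambda_{xy}$ times column $x$
(`reduced_apply`). The result consists of path generating functions of the reduced flow graph; as
that graph has no full flow, the determinant is zero (`det_reduced_eq_zero`), and expanding in the
column of $y$ gives $\det A_{j_0}=\lambda_{xy}\det A$. The leading coefficient $\det A$ does not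
vanish (`det_flowCovariance_ne_zero`): a direct argument is blocked because $\lambda_{uv}$ labels
one edge among the sink copies and one outside them. Each path crosses into the sink copies once, by
$u_i^*\to v_i'$. Specializing $\Omega=CC^\top$, where the columns of $C$ interpolate between the
unit vectors at $u_i$ and $v_i$, factors the determinant into one factor per side. Evaluating at the
two ends of the interpolation leaves two path determinants, in each of which every indeterminate
labels a single edge. The order puts the $\lambda$ by the round of the recursion in which they are
identified, and all $\omega$ after them, since $\Omega=(I-\Lambda)^\top\Sigma(I-\Lambda)$ on the
graph of the parametrization. -/

namespace MixedGraph

/-! ### Determinants of path generating functions -/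

section PathSystems

variable {N : Type*} {k : ℕ}

/-- A permutation of the nodes and the indices of the sources and targets is compatible with a
relation on the nodes if it sends each index to the corresponding source, and moves each node along
an edge, or fixes it, or sends it to the index for which it is the target. -/
def FlowStep (edge : N → N → Prop) (src tgt : Fin k → N) : N ⊕ Fin k → N ⊕ Fin k → Prop
  | .inl v, .inl w => v = w ∨ edge v w
  | .inl v, .inr j => v = tgt j
  | .inr i, .inl w => w = src i
  | .inr _, .inr _ => False

theorem isChain_mem_cases {R : N → N → Prop} {x : N} :
    ∀ {l : List N}, l.IsChain R → x ∈ l → l.head? = some x ∨ ∃ y ∈ l, R y x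
  | [], _, h => by simp at h
  | [a], _, h => by simp at h; simp [h]
  | a :: b :: l, hc, h => by
    rw [List.isChain_cons_cons] at hc
    rcases List.mem_cons.1 h with rfl | h
    · simp
    · rcases isChain_mem_cases hc.2 h with h' | ⟨y, hy, hyx⟩
      · right
        simp only [List.head?_cons, Option.some.injEq] at h'
        subst h'
        exact ⟨a, by simp, hc.1⟩
      · exact .inr ⟨y, List.mem_cons_of_mem _ hy, hyx⟩

theorem nodup_of_isChain_of_rank {R : N → N → Prop} {b : N → ℕ} (hb : ∀ v w, R v w → b v < b w)
    {l : List N} (h : l.IsChain R) : l.Nodup := by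
  have h1 : l.IsChain (fun v w => b v < b w) := h.imp fun {a c} hac => hb _ _ hac
  have : IsTrans N (fun v w => b v < b w) := ⟨fun _ _ _ => lt_trans⟩
  exact (List.isChain_iff_pairwise.1 h1).imp fun hab => by rintro rfl; exact lt_irrefl _ hab

theorem formPerm_rel {α : Type*} [DecidableEq α] {R : α → α → Prop} {a : α} {l : List α}
    (hn : (a :: l).Nodup) (hc : (a :: l).IsChain R) (hl : R ((a :: l).getLast (by simp)) a)
    {x : α} (hx : x ∈ a :: l) : R x ((a :: l).formPerm x) := by
  obtain ⟨n, hnl, rfl⟩ := List.getElem_of_mem hx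
  rw [List.formPerm_apply_getElem _ hn]
  by_cases h : n + 1 < (a :: l).length
  · simp only [Nat.mod_eq_of_lt h]
    exact List.isChain_iff_getElem.1 hc n h
  · have hn' : n = (a :: l).length - 1 := by omega
    have h0 : (n + 1) % (a :: l).length = 0 := by
      rw [show n + 1 = (a :: l).length by omega, Nat.mod_self]
    simp only [h0, List.getElem_cons_zero]
    rw [List.getLast_eq_getElem] at hl
    simpa only [hn'] using hl

/-- Each path, closed up through its index, is a cycle; disjointness of the paths makes these cycles
disjoint, and all other nodes are fixed. -/
theorem exists_perm_flowStep [Finite N] {edge : N → N → Prop} {src tgt : Fin k → N} {b : N → ℕ}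
    (hb : ∀ v w, edge v w → b v < b w) {path : Fin k → List N}
    (hp : ∀ i, (path i).IsChain edge ∧ (path i).head? = some (src i) ∧
      (path i).getLast? = some (tgt i))
    (hd : ∀ i j, i ≠ j → (path i).Disjoint (path j)) :
    ∃ σ : Equiv.Perm (N ⊕ Fin k), ∀ x, FlowStep edge src tgt x (σ x) := by
  classical
  let L : Fin k → List (N ⊕ Fin k) := fun i => .inr i :: (path i).map .inl
  have hLd : ∀ {i j x}, x ∈ L i → x ∈ L j → i = j := by
    intro i j x hi hj
    by_contra hij
    rcases x with x | x
    · exact hd i j hij (by simpa [L] using hi) (by simpa [L] using hj)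
    · simp [L] at hi hj
      exact hij (hi.symm.trans hj)
  have hLn : ∀ i, (L i).Nodup := fun i => by
    simpa [L] using (nodup_of_isChain_of_rank hb (hp i).1).map Sum.inl_injective
  have hstep : ∀ i, ∀ x ∈ L i, FlowStep edge src tgt x ((L i).formPerm x) := by
    intro i x hx
    refine formPerm_rel (hLn i) ?_ ?_ hx
    · rw [List.isChain_cons]
      refine ⟨fun y hy => ?_, List.isChain_map_of_isChain (R := edge) Sum.inl
        (fun a c h => Or.inr h) (hp i).1⟩
      simp only [List.head?_map, (hp i).2.1, Option.map_some, Option.mem_def,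
        Option.some.injEq] at hy
      subst hy
      rfl
    · have : (L i).getLast? = some (.inl (tgt i)) := by
        simp [L, List.getLast?_cons, (hp i).2.2]
      have h2 : (L i).getLast (by simp [L]) = .inl (tgt i) := by
        rw [List.getLast?_eq_some_getLast (by simp [L])] at this
        simpa using this
      change FlowStep edge src tgt ((L i).getLast (by simp [L])) _
      rw [h2]
      rfl
  let f : N ⊕ Fin k → N ⊕ Fin k := fun x =>
    if h : ∃ i, x ∈ L i then (L h.choose).formPerm x else x
  have hf : ∀ {i x}, x ∈ L i → f x = (L i).formPerm x := by
    intro i x hx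
    have h : ∃ i, x ∈ L i := ⟨i, hx⟩
    simp only [f, dif_pos h]
    rw [hLd h.choose_spec hx]
  have hf' : ∀ {x}, (¬ ∃ i, x ∈ L i) → f x = x := fun h => by simp only [f, dif_neg h]
  have hinj : Function.Injective f := by
    intro x y hxy
    by_cases hx : ∃ i, x ∈ L i <;> by_cases hy : ∃ i, y ∈ L i
    · obtain ⟨i, hi⟩ := hx
      obtain ⟨j, hj⟩ := hy
      rw [hf hi, hf hj] at hxy
      have h1 := List.formPerm_apply_mem_of_mem hi
      rw [hxy] at h1
      obtain rfl := hLd h1 (List.formPerm_apply_mem_of_mem hj)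
      exact (L i).formPerm.injective hxy
    · obtain ⟨i, hi⟩ := hx
      rw [hf hi, hf' hy] at hxy
      exact absurd ⟨i, hxy ▸ List.formPerm_apply_mem_of_mem hi⟩ hy
    · obtain ⟨i, hi⟩ := hy
      rw [hf hi, hf' hx] at hxy
      exact absurd ⟨i, hxy ▸ List.formPerm_apply_mem_of_mem hi⟩ hx
    · rwa [hf' hx, hf' hy] at hxy
  refine ⟨Equiv.ofBijective f (Finite.injective_iff_bijective.1 hinj), fun x => ?_⟩
  change FlowStep edge src tgt x (f x)
  by_cases hx : ∃ i, x ∈ L i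
  · obtain ⟨i, hi⟩ := hx
    rw [hf hi]
    exact hstep i x hi
  · rw [hf' hx]
    rcases x with x | x
    · exact Or.inl rfl
    · exact absurd ⟨x, by simp [L]⟩ hx

/-- Iterating the permutation from a source follows edges of increasing rank, so it must reach an
index, which marks a target. Injectivity of the permutation makes the resulting paths disjoint. -/
theorem hasFullFlow_of_flowStep [Finite N] {edge : N → N → Prop} {src tgt : Fin k → N} {b : N → ℕ}
    (hb : ∀ v w, edge v w → b v < b w) (σ : Equiv.Perm (N ⊕ Fin k))
    (hσ : ∀ x, FlowStep edge src tgt x (σ x)) : HasFullFlow edge src tgt := by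
  obtain ⟨B, hB⟩ : ∃ B, ∀ v, b v < B := by
    obtain ⟨B, hB⟩ := (Set.finite_range b).bddAbove
    exact ⟨B + 1, fun v => Nat.lt_succ_of_le (hB ⟨v, rfl⟩)⟩
  let R : N → N → Prop := fun v w => edge v w ∧ σ (.inl v) = .inl w
  have hpath : ∀ n v, B - b v ≤ n → σ (.inl v) ≠ .inl v →
      ∃ (l : List N) (j : Fin k), l.IsChain R ∧ l.head? = some v ∧
        ∃ z, l.getLast? = some z ∧ σ (.inl z) = .inr j := by
    intro n
    induction n with
    | zero => intro v hv; have := hB v; omega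
    | succ n ih =>
      intro v hv hne
      rcases hw : σ (.inl v) with w | j
      · have hstep := hσ (.inl v)
        rw [hw] at hstep
        have hvw : edge v w := by
          rcases hstep with rfl | h
          · exact absurd hw hne
          · exact h
        have hlt := hb v w hvw
        have := hB w
        obtain ⟨l, j, hl, hhead, z, hz, hj⟩ := ih w (by omega) (by
          intro h
          rw [← hw] at h
          exact hne (σ.injective h))
        refine ⟨v :: l, j, ?_, rfl, z, ?_, hj⟩
        · rw [List.isChain_cons]
          refine ⟨fun y hy => ?_, hl⟩
          rw [hhead] at hy
          simp only [Option.mem_def, Option.some.injEq] at hy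
          subst hy
          exact ⟨hvw, hw⟩
        · simp [List.getLast?_cons, hz]
      · exact ⟨[v], j, by simp, rfl, v, rfl, hw⟩
  have hsrc : ∀ i, σ (.inr i) = .inl (src i) := by
    intro i
    have h := hσ (.inr i)
    rcases hx : σ (.inr i) with w | j
    · rw [hx] at h
      rw [show w = src i from h]
    · rw [hx] at h
      exact h.elim
  have hP : ∀ i, ∃ (l : List N) (j : Fin k), l.IsChain R ∧ l.head? = some (src i) ∧
        ∃ z, l.getLast? = some z ∧ σ (.inl z) = .inr j := fun i =>
    hpath _ (src i) le_rfl fun h => by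
      rw [← hsrc i] at h
      have h' := σ.injective h
      rw [hsrc] at h'
      cases h'
  choose path π hc hh z hz hπ using hP
  -- A common node is traced backwards: its preimage under `σ` is unique, so it lies on both paths
  -- and has smaller rank, or is the index of both.
  have hdis : ∀ n x, b x ≤ n → ∀ i j, x ∈ path i → x ∈ path j → i = j := by
    intro n
    induction n with
    | zero =>
      intro x hx i j hi hj
      rcases isChain_mem_cases (hc i) hi with h | ⟨y, -, hy⟩
      · rcases isChain_mem_cases (hc j) hj with h' | ⟨y', -, hy'⟩
        · rw [hh] at h h'
          have : σ (.inr i) = σ (.inr j) := by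
            rw [hsrc, hsrc, Option.some.inj h, Option.some.inj h']
          simpa using this
        · have := hb _ _ hy'.1; omega
      · have := hb _ _ hy.1; omega
    | succ n ih =>
      intro x hx i j hi hj
      rcases isChain_mem_cases (hc i) hi with h | ⟨y, hyi, hy⟩ <;>
      rcases isChain_mem_cases (hc j) hj with h' | ⟨y', hyj, hy'⟩
      · rw [hh] at h h'
        have : σ (.inr i) = σ (.inr j) := by
          rw [hsrc, hsrc, Option.some.inj h, Option.some.inj h']
        simpa using this
      · rw [hh] at h
        have : σ (.inr i) = σ (.inl y') := by rw [hsrc, hy'.2, Option.some.inj h]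
        simp at this
      · rw [hh] at h'
        have : σ (.inr j) = σ (.inl y) := by rw [hsrc, hy.2, Option.some.inj h']
        simp at this
      · have : σ (.inl y) = σ (.inl y') := by rw [hy.2, hy'.2]
        obtain rfl : y = y' := by simpa using this
        have := hb _ _ hy.1
        exact ih y (by omega) i j hyi hyj
  have hπinj : Function.Injective π := by
    intro i j hij
    have : σ (.inl (z i)) = σ (.inl (z j)) := by rw [hπ, hπ, hij]
    have hzz : z i = z j := by simpa using this
    exact hdis _ (z i) le_rfl i j (List.mem_of_getLast? (hz i))
      (hzz ▸ List.mem_of_getLast? (hz j))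
  refine ⟨Equiv.ofBijective π (Finite.injective_iff_bijective.1 hπinj), path, fun i =>
    ⟨(hc i).imp fun {a c} h => h.1, hh i, ?_⟩, fun i j hij x hi hj => hij (hdis _ x le_rfl i j hi hj)⟩
  rw [hz i]
  have h := hσ (.inl (z i))
  rw [hπ i] at h
  exact congrArg some h

theorem HasFullFlow.mono {edge edge' : N → N → Prop} {src tgt : Fin k → N}
    (h : ∀ v w, edge v w → edge' v w) (hf : HasFullFlow edge src tgt) :
    HasFullFlow edge' src tgt := by
  obtain ⟨π, path, hp, hd⟩ := hf
  exact ⟨π, path, fun i => ⟨(hp i).1.imp fun {a c} hac => h _ _ hac, (hp i).2⟩, hd⟩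

end PathSystems

/-! ### The bordered matrix of a weighted acyclic graph -/

section BorderedMatrix

open Matrix

variable {N : Type*} [Fintype N] [DecidableEq N] {k : ℕ} {R : Type*} [CommRing R]

/-- The matrix whose `j`-th column is the unit vector at `tgt j`. -/
def unitColumns (R : Type*) [CommRing R] {N : Type*} [DecidableEq N] {k : ℕ} (tgt : Fin k → N) :
    Matrix N (Fin k) R :=
  fun v j => if v = tgt j then 1 else 0

/-- The matrix `1 - W`, bordered by the unit columns of the targets and the unit rows of the
sources. -/
def borderedMatrix (W : Matrix N N R) (src tgt : Fin k → N) :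
    Matrix (N ⊕ Fin k) (N ⊕ Fin k) R :=
  fromBlocks (1 - W) (unitColumns R tgt) (unitColumns R src)ᵀ 0

theorem unitColumns_transpose_mul {m : Type*} (src : Fin k → N) (Z : Matrix N m R) :
    (unitColumns R src)ᵀ * Z = Z.submatrix src id := by
  ext i j
  simp [unitColumns, Matrix.mul_apply]

theorem mul_unitColumns {m : Type*} (tgt : Fin k → N) (Z : Matrix m N R) :
    Z * unitColumns R tgt = Z.submatrix id tgt := by
  ext i j
  simp [unitColumns, Matrix.mul_apply]

/-- A column operation with `Z` clears the upper right block. The equation for `Z` says that its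
entries sum the weights of the paths to the targets; stating it this way avoids the inverse of `1 -
W`. -/
theorem det_borderedMatrix (W : Matrix N N R) (src tgt : Fin k → N) (Z : Matrix N (Fin k) R)
    (hZ : (1 - W) * Z = unitColumns R tgt) :
    (borderedMatrix W src tgt).det = (1 - W).det * (-(Z.submatrix src id)).det := by
  have h : borderedMatrix W src tgt * fromBlocks 1 (-Z) 0 1 =
      fromBlocks (1 - W) 0 (unitColumns R src)ᵀ (-(Z.submatrix src id)) := by
    rw [borderedMatrix, fromBlocks_multiply]
    simp [hZ, unitColumns_transpose_mul]
  have h2 := congrArg Matrix.det h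
  rwa [det_mul, det_fromBlocks_zero₂₁, det_fromBlocks_zero₁₂, det_one, det_one, mul_one,
    mul_one] at h2

/-- A permutation with nonzero term satisfies `b (σ v) ≤ b v` everywhere; both sides have the same
sum, so equality holds and every node is fixed. -/
theorem det_one_sub_of_rank (W : Matrix N N R) (b : N → ℕ)
    (hb : ∀ v w, W v w ≠ 0 → b v < b w) : (1 - W).det = 1 := by
  have hdiag : ∀ v, W v v = 0 := fun v => by
    by_contra h
    exact lt_irrefl _ (hb v v h)
  rw [det_apply', Finset.sum_eq_single 1]
  · simp [hdiag]
  · intro σ _ hσ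
    by_cases hz : ∀ v, (1 - W) (σ v) v ≠ 0
    · exfalso
      have hle : ∀ v, b (σ v) ≤ b v := fun v => by
        by_cases h : σ v = v
        · rw [h]
        · refine (hb (σ v) v fun h0 => hz v ?_).le
          simp [h0, one_apply_ne h]
      have heq : ∑ v, b (σ v) = ∑ v, b v := Equiv.sum_comp σ b
      have heq' := (Finset.sum_eq_sum_iff_of_le fun v _ => hle v).1 heq
      refine hσ (Equiv.ext fun v => ?_)
      by_contra h
      have h : σ v ≠ v := h
      have := hb (σ v) v fun h0 => hz v (by simp [h0, one_apply_ne h])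
      have := heq' v (Finset.mem_univ v)
      omega
    · push Not at hz
      obtain ⟨v, hv⟩ := hz
      exact mul_eq_zero_of_right _ (Finset.prod_eq_zero (Finset.mem_univ v) hv)
  · simp

theorem hasFullFlow_of_det_ne_zero (W : Matrix N N R) (b : N → ℕ)
    (hb : ∀ v w, W v w ≠ 0 → b v < b w) (src tgt : Fin k → N) (Z : Matrix N (Fin k) R)
    (hZ : (1 - W) * Z = unitColumns R tgt) (hdet : (Z.submatrix src id).det ≠ 0) :
    HasFullFlow (fun v w => W v w ≠ 0) src tgt := by
  -- The transpose makes the Leibniz products run over the entries `(x, σ x)`, the direction of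
  -- `FlowStep`.
  have hB : (borderedMatrix W src tgt)ᵀ.det ≠ 0 := by
    rw [det_transpose, det_borderedMatrix W src tgt Z hZ, det_one_sub_of_rank W b hb, one_mul,
      det_neg]
    intro h
    apply hdet
    have := congrArg ((-1) ^ Fintype.card (Fin k) * ·) h
    simpa [← mul_assoc, ← mul_pow] using this
  rw [det_apply'] at hB
  obtain ⟨σ, -, hσ⟩ := Finset.exists_ne_zero_of_sum_ne_zero hB
  refine hasFullFlow_of_flowStep hb σ fun x => ?_
  have hx : borderedMatrix W src tgt x (σ x) ≠ 0 := fun h =>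
    hσ (by rw [Finset.prod_eq_zero (Finset.mem_univ x) h, mul_zero])
  rcases x with v | i <;> rcases hy : σ _ with w | j <;> rw [hy] at hx
  · by_cases hvw : v = w
    · exact .inl hvw
    · refine .inr fun h => hx ?_
      simp [borderedMatrix, h, one_apply_ne hvw]
  · by_contra h
    exact hx (if_neg h)
  · by_contra h
    exact hx (if_neg h)
  · exact hx rfl

end BorderedMatrix

end MixedGraph

namespace MixedGraph

/-! ### Absence of cancellation when the indeterminates label distinct edges -/

section LabelledGraphs

open Matrix MvPolynomial

variable {N ι : Type*} {k : ℕ}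

/-- The weight of an edge labelled by an optional indeterminate: unlabelled edges have weight one,
and non-edges (label `none`) have weight zero. -/
noncomputable def labelWeight (ℓ : N → N → Option (Option ι)) : Matrix N N (MvPolynomial ι ℝ) :=
  fun v w =>
    match ℓ v w with
    | none => 0
    | some none => 1
    | some (some e) => X e

/-- The exponent of the monomial in an entry of the bordered matrix of a labelled graph. -/
noncomputable def labelExponent (ℓ : N → N → Option (Option ι)) :
    N ⊕ Fin k → N ⊕ Fin k → ι →₀ ℕ
  | .inl v, .inl w =>
    match ℓ v w with
    | some (some e) => Finsupp.single e 1
    | _ => 0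
  | _, _ => 0

open Classical in
/-- The coefficient of the monomial in an entry of the bordered matrix of a labelled graph. -/
noncomputable def labelCoefficient (ℓ : N → N → Option (Option ι)) (src tgt : Fin k → N) :
    N ⊕ Fin k → N ⊕ Fin k → ℝ
  | .inl v, .inl w => (if v = w then 1 else 0) - (if ℓ v w = none then 0 else 1)
  | .inl v, .inr j => if v = tgt j then 1 else 0
  | .inr i, .inl w => if w = src i then 1 else 0
  | .inr _, .inr _ => 0

theorem labelCoefficient_ne_zero_iff {ℓ : N → N → Option (Option ι)} (hirr : ∀ v, ℓ v v = none)
    {src tgt : Fin k → N} {x y : N ⊕ Fin k} :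
    labelCoefficient ℓ src tgt x y ≠ 0 ↔ FlowStep (fun v w => ℓ v w ≠ none) src tgt x y := by
  rcases x with v | i <;> rcases y with w | j
  · by_cases hvw : v = w
    · subst hvw
      simp [labelCoefficient, FlowStep, hirr]
    · simp [labelCoefficient, FlowStep, hvw]
  · simp [labelCoefficient, FlowStep]
  · simp [labelCoefficient, FlowStep]
  · simp [labelCoefficient, FlowStep]

theorem borderedMatrix_labelWeight [Fintype N] [DecidableEq N] {ℓ : N → N → Option (Option ι)}
    (hirr : ∀ v, ℓ v v = none) (src tgt : Fin k → N) (x y : N ⊕ Fin k) :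
    borderedMatrix (labelWeight ℓ) src tgt x y =
      monomial (labelExponent ℓ x y) (labelCoefficient ℓ src tgt x y) := by
  rcases x with v | i <;> rcases y with w | j
  · by_cases hvw : v = w
    · subst hvw
      simp [borderedMatrix, labelWeight, labelExponent, labelCoefficient, hirr]
    · rcases h : ℓ v w with _ | _ | e
      · simp [borderedMatrix, labelWeight, labelExponent, labelCoefficient, hvw, h]
      · simp [borderedMatrix, labelWeight, labelExponent, labelCoefficient, hvw, h]
      · simp [borderedMatrix, labelWeight, labelExponent, labelCoefficient, hvw, h, X]
  · by_cases h : v = tgt j <;>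
      simp [borderedMatrix, labelExponent, labelCoefficient, unitColumns, h]
  · by_cases h : w = src i <;>
      simp [borderedMatrix, labelExponent, labelCoefficient, unitColumns, h]
  · simp [borderedMatrix, labelExponent, labelCoefficient]

theorem exists_label_of_labelExponent_ne_zero {ℓ : N → N → Option (Option ι)}
    {x y : N ⊕ Fin k} {e : ι} (h : labelExponent ℓ x y e ≠ 0) :
    ∃ v w, x = .inl v ∧ y = .inl w ∧ ℓ v w = some (some e) := by
  rcases x with v | i <;> rcases y with w | j
  · rcases hl : ℓ v w with _ | _ | e'
    · simp [labelExponent, hl] at h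
    · simp [labelExponent, hl] at h
    · simp only [labelExponent, hl, ne_eq] at h
      have : e' = e := by
        by_contra h'
        simp [h'] at h
      exact ⟨v, w, rfl, rfl, this ▸ hl⟩
  · simp [labelExponent] at h
  · simp [labelExponent] at h
  · simp [labelExponent] at h

/-- Permutations compatible with a labelled graph that use the same labels agree. -/
theorem perm_eq_of_labelExponent_eq [Fintype N] {ℓ : N → N → Option (Option ι)}
    (hinj : ∀ {v w v' w' e}, ℓ v w = some (some e) → ℓ v' w' = some (some e) → v = v' ∧ w = w')
    {O : Set N} (hO : ∀ {v w}, ℓ v w = some none → v ∈ O ∧ w ∉ O)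
    (hO' : ∀ {v w w'}, ℓ v w = some none → ℓ v w' = some none → w = w')
    {src tgt : Fin k → N} {σ ρ : Equiv.Perm (N ⊕ Fin k)}
    (hσ : ∀ x, FlowStep (fun v w => ℓ v w ≠ none) src tgt x (σ x))
    (hρ : ∀ x, FlowStep (fun v w => ℓ v w ≠ none) src tgt x (ρ x))
    (h : ∑ x, (labelExponent ℓ x (σ x) : ι →₀ ℕ) = ∑ x, labelExponent ℓ x (ρ x)) : σ = ρ := by
  have key : ∀ {σ ρ : Equiv.Perm (N ⊕ Fin k)},
      (∑ x, (labelExponent ℓ x (σ x) : ι →₀ ℕ) = ∑ x, labelExponent ℓ x (ρ x)) →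
      ∀ {v w e}, σ (.inl v) = .inl w → ℓ v w = some (some e) → ρ (.inl v) = .inl w := by
    intro σ ρ h v w e hvw he
    have h1 : (∑ x, (labelExponent ℓ x (σ x) : ι →₀ ℕ)) e ≠ 0 := by
      rw [Finsupp.finsetSum_apply]
      refine (Finset.sum_pos' (fun _ _ => Nat.zero_le _) ⟨.inl v, Finset.mem_univ _, ?_⟩).ne'
      simp [hvw, labelExponent, he]
    rw [h, Finsupp.finsetSum_apply] at h1
    obtain ⟨x, -, hx⟩ := Finset.exists_ne_zero_of_sum_ne_zero h1
    obtain ⟨v', w', rfl, hw', hl⟩ := exists_label_of_labelExponent_ne_zero hx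
    obtain ⟨rfl, rfl⟩ := hinj he hl
    exact hw'
  have hsrc : ∀ {σ : Equiv.Perm (N ⊕ Fin k)},
      (∀ x, FlowStep (fun v w => ℓ v w ≠ none) src tgt x (σ x)) →
      ∀ i, σ (.inr i) = .inl (src i) := by
    intro σ hσ i
    have h := hσ (.inr i)
    rcases hx : σ (.inr i) with w | j
    · rw [hx] at h
      rw [show w = src i from h]
    · rw [hx] at h
      exact h.elim
  -- Unlabelled edges never enter `O`, so a moved node of `O` is entered from a source index or
  -- along a labelled edge. Both are common to the two permutations, so such a node cannot be fixed
  -- by only one of them.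
  have fixed : ∀ {σ ρ : Equiv.Perm (N ⊕ Fin k)},
      (∀ x, FlowStep (fun v w => ℓ v w ≠ none) src tgt x (σ x)) →
      (∀ x, FlowStep (fun v w => ℓ v w ≠ none) src tgt x (ρ x)) →
      (∑ x, (labelExponent ℓ x (σ x) : ι →₀ ℕ) = ∑ x, labelExponent ℓ x (ρ x)) →
      ∀ {v}, v ∈ O → σ (.inl v) = .inl v → ρ (.inl v) = .inl v := by
    intro σ ρ hσ hρ h v hv hfix
    obtain ⟨x, hx⟩ := ρ.surjective (.inl v)
    rcases x with w | i
    · have hstep := hρ (.inl w)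
      rw [hx] at hstep
      rcases hstep with rfl | hstep
      · exact hx
      · rcases hl : ℓ w v with _ | _ | e
        · exact absurd hl hstep
        · exact absurd hv (hO hl).2
        · have := key h.symm hx hl
          rw [← hfix] at this
          have : w = v := by simpa using this
          rw [← this] at hx ⊢
          exact hx
    · rw [hsrc hρ] at hx
      rw [← hx, ← hsrc hσ i] at hfix
      have := σ.injective hfix
      rw [hsrc hσ] at this
      cases this
  have target : ∀ {σ ρ : Equiv.Perm (N ⊕ Fin k)},
      (∀ x, FlowStep (fun v w => ℓ v w ≠ none) src tgt x (σ x)) →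
      (∀ x, FlowStep (fun v w => ℓ v w ≠ none) src tgt x (ρ x)) →
      ∀ {v j}, σ (.inl v) = .inr j → ρ (.inl v) = .inr j := by
    intro σ ρ hσ hρ v j hj
    obtain ⟨x, hx⟩ := ρ.surjective (.inr j)
    have h1 := hσ (.inl v)
    rw [hj] at h1
    rcases x with w | i
    · have h2 := hρ (.inl w)
      rw [hx] at h2
      have hw : w = v := (show w = tgt j from h2).trans (show v = tgt j from h1).symm
      rwa [hw] at hx
    · rw [hsrc hρ] at hx
      cases hx
  refine Equiv.ext fun x => ?_
  rcases x with v | i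
  · rcases hs : σ (.inl v) with w | j
    · rcases hr : ρ (.inl v) with w' | j
      · have h1 := hσ (.inl v)
        have h2 := hρ (.inl v)
        rw [hs] at h1
        rw [hr] at h2
        rcases h1 with rfl | h1
        · rcases h2 with rfl | h2
          · rfl
          · rcases hl : ℓ v w' with _ | _ | e
            · exact absurd hl h2
            · rw [← hr, fixed hσ hρ h (hO hl).1 hs]
            · rw [← hs, key h.symm hr hl]
        · rcases hl : ℓ v w with _ | _ | e
          · exact absurd hl h1
          · rcases h2 with rfl | h2
            · rw [← hs, fixed hρ hσ h.symm (hO hl).1 hr]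
            · rcases hl' : ℓ v w' with _ | _ | e
              · exact absurd hl' h2
              · rw [hO' hl hl']
              · rw [← hs, key h.symm hr hl']
          · rw [← hr, key h hs hl]
      · rw [← hs, target hρ hσ hr]
    · rw [target hσ hρ hs]
  · rw [hsrc hσ, hsrc hρ]

/-- The monomial of `σ` arises from no other compatible permutation, so its coefficient in the
determinant is a single nonzero product up to sign. -/
theorem det_borderedMatrix_labelWeight_ne_zero [Fintype N] [DecidableEq N]
    {ℓ : N → N → Option (Option ι)} (hirr : ∀ v, ℓ v v = none)
    (hinj : ∀ {v w v' w' e}, ℓ v w = some (some e) → ℓ v' w' = some (some e) → v = v' ∧ w = w')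
    {O : Set N} (hO : ∀ {v w}, ℓ v w = some none → v ∈ O ∧ w ∉ O)
    (hO' : ∀ {v w w'}, ℓ v w = some none → ℓ v w' = some none → w = w')
    {src tgt : Fin k → N} {σ : Equiv.Perm (N ⊕ Fin k)}
    (hσ : ∀ x, FlowStep (fun v w => ℓ v w ≠ none) src tgt x (σ x)) :
    (borderedMatrix (labelWeight ℓ) src tgt).det ≠ 0 := by
  classical
  rw [← det_transpose, det_apply']
  intro h0
  have h1 := congrArg (coeff (∑ x, labelExponent ℓ x (σ x))) h0
  have h2 : ∀ ρ : Equiv.Perm (N ⊕ Fin k),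
      coeff (∑ x, labelExponent ℓ x (σ x)) (((Equiv.Perm.sign ρ : ℤ) : MvPolynomial ι ℝ) *
        ∏ x, (borderedMatrix (labelWeight ℓ) src tgt)ᵀ (ρ x) x) =
      (Equiv.Perm.sign ρ : ℤ) *
        if (∑ x, labelExponent ℓ x (ρ x)) = ∑ x, labelExponent ℓ x (σ x) then
          ∏ x, labelCoefficient ℓ src tgt x (ρ x) else 0 := by
    intro ρ
    rw [← map_intCast (C : ℝ →+* MvPolynomial ι ℝ), coeff_C_mul]
    simp only [transpose_apply, borderedMatrix_labelWeight hirr, ← monomial_sum_prod,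
      coeff_monomial]
  rw [coeff_sum, Finset.sum_congr rfl fun ρ _ => h2 ρ, Finset.sum_eq_single σ] at h1
  · rw [if_pos rfl, coeff_zero] at h1
    have h3 : ∏ x, labelCoefficient ℓ src tgt x (σ x) ≠ 0 :=
      Finset.prod_ne_zero_iff.2 fun x _ => (labelCoefficient_ne_zero_iff hirr).2 (hσ x)
    refine (mul_ne_zero ?_ h3) h1
    exact Int.cast_ne_zero.2 (Units.ne_zero _)
  · intro ρ _ hρ
    split_ifs with he
    · refine mul_eq_zero_of_right _ ?_
      by_contra h3
      replace h3 := Finset.prod_ne_zero_iff.1 h3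
      exact hρ (perm_eq_of_labelExponent_eq hinj hO hO'
        (fun x => (labelCoefficient_ne_zero_iff hirr).1 (h3 x (Finset.mem_univ x))) hσ he)
    · simp
  · simp

/-- The determinant of the path generating functions of a labelled graph does not vanish if there
is a system of disjoint paths from the sources to the targets. -/
theorem det_submatrix_ne_zero_of_paths [Fintype N] [DecidableEq N]
    {ℓ : N → N → Option (Option ι)} {b : N → ℕ} (hb : ∀ v w, ℓ v w ≠ none → b v < b w)
    (hinj : ∀ {v w v' w' e}, ℓ v w = some (some e) → ℓ v' w' = some (some e) → v = v' ∧ w = w')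
    {O : Set N} (hO : ∀ {v w}, ℓ v w = some none → v ∈ O ∧ w ∉ O)
    (hO' : ∀ {v w w'}, ℓ v w = some none → ℓ v w' = some none → w = w')
    {src tgt : Fin k → N}
    {path : Fin k → List N}
    (hp : ∀ i, (path i).IsChain (fun v w => ℓ v w ≠ none) ∧ (path i).head? = some (src i) ∧
      (path i).getLast? = some (tgt i))
    (hd : ∀ i j, i ≠ j → (path i).Disjoint (path j))
    (Z : Matrix N (Fin k) (MvPolynomial ι ℝ))
    (hZ : (1 - labelWeight ℓ) * Z = unitColumns _ tgt) : (Z.submatrix src id).det ≠ 0 := by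
  obtain ⟨σ, hσ⟩ := exists_perm_flowStep hb hp hd
  have h := det_borderedMatrix_labelWeight_ne_zero (fun v => by
    by_contra hv
    exact lt_irrefl _ (hb v v hv)) hinj hO hO' hσ
  rw [det_borderedMatrix _ src tgt Z hZ, det_neg] at h
  intro h0
  rw [h0] at h
  simp at h

end LabelledGraphs

end MixedGraph

namespace MixedGraph

open Matrix

variable {V : Type*}

theorem IsAcyclic.exists_rank [Finite V] {G : MixedGraph V} (hG : G.IsAcyclic) :
    ∃ b : V → ℕ, ∀ u v, G.dir u v → b u < b v := by
  refine ⟨fun v => {u | Relation.TransGen G.dir u v}.ncard, fun u v h => ?_⟩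
  refine Set.ncard_lt_ncard ⟨fun w hw => Relation.TransGen.tail hw h, fun hsub => ?_⟩
    (Set.toFinite _)
  exact hG u (hsub (Relation.TransGen.single h))

/-! ### Block matrices over the nodes of the flow graph -/

section FlowNodes

/-- The matrix with rows indexed by the flow nodes obtained by stacking three matrices. -/
def flowRows {m R : Type*} (X Y S : Matrix V m R) : Matrix (FlowNode V) m R
  | .obs v, j => X v j
  | .aux v, j => Y v j
  | .sink v, j => S v j

theorem flowRows_map {m R R' : Type*} (f : R → R') (X Y S : Matrix V m R) :
    (flowRows X Y S).map f = flowRows (X.map f) (Y.map f) (S.map f) := by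
  ext x j
  rcases x with v | v | v <;> rfl

variable {R : Type*} [CommRing R]

instance FlowNode.instDecidableEq [DecidableEq V] : DecidableEq (FlowNode V) := fun a b =>
  match a, b with
  | .obs v, .obs w => decidable_of_iff (v = w) (by simp)
  | .aux v, .aux w => decidable_of_iff (v = w) (by simp)
  | .sink v, .sink w => decidable_of_iff (v = w) (by simp)
  | .obs _, .aux _ | .obs _, .sink _ | .aux _, .obs _ | .aux _, .sink _ | .sink _, .obs _
  | .sink _, .aux _ => isFalse (by simp)

/-- A node of the flow graph is one of three copies of a node of the mixed graph. -/
def FlowNode.equivSum : V ⊕ V ⊕ V ≃ FlowNode V where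
  toFun
    | .inl v => .obs v
    | .inr (.inl v) => .aux v
    | .inr (.inr v) => .sink v
  invFun
    | .obs v => .inl v
    | .aux v => .inr (.inl v)
    | .sink v => .inr (.inr v)
  left_inv := by rintro (v | v | v) <;> rfl
  right_inv := by rintro (v | v | v) <;> rfl

instance FlowNode.instFintype [Fintype V] : Fintype (FlowNode V) :=
  Fintype.ofEquiv _ FlowNode.equivSum

theorem FlowNode.sum_eq [Fintype V] (f : FlowNode V → R) :
    ∑ x, f x = ∑ v, f (.obs v) + ∑ v, f (.aux v) + ∑ v, f (.sink v) := by
  rw [← FlowNode.equivSum.sum_comp, Fintype.sum_sum_type, Fintype.sum_sum_type, add_assoc]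
  rfl

/-- The weighted adjacency matrix of a flow graph. -/
def flowWeight [DecidableEq V] (P Q O L : Matrix V V R) : Matrix (FlowNode V) (FlowNode V) R
  | .obs v, .obs u => P v u
  | .obs v, .aux w => if v = w then 1 else 0
  | .aux v, .obs u => Q v u
  | .aux u, .sink v => O u v
  | .sink u, .sink v => L u v
  | _, _ => 0

theorem one_sub_flowWeight_mul [Fintype V] [DecidableEq V] {m : Type*} (P Q O L : Matrix V V R)
    (X Y S : Matrix V m R) :
    (1 - flowWeight P Q O L) * flowRows X Y S =
      flowRows (X - P * X - Y) (Y - Q * X - O * S) (S - L * S) := by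
  rw [Matrix.sub_mul, Matrix.one_mul]
  ext x j
  rw [Matrix.sub_apply, Matrix.mul_apply, FlowNode.sum_eq]
  rcases x with v | v | v
  · simp [flowWeight, flowRows, Matrix.mul_apply, sub_sub]
  · simp [flowWeight, flowRows, Matrix.mul_apply, sub_sub]
  · simp [flowWeight, flowRows, Matrix.mul_apply]

theorem flowRows_mul [Fintype V] {m n : Type*} [Fintype m] (X Y S : Matrix V m R)
    (Z : Matrix m n R) : flowRows X Y S * Z = flowRows (X * Z) (Y * Z) (S * Z) := by
  ext x j
  rcases x with v | v | v <;> rfl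

theorem unitColumns_aux [DecidableEq V] {k : ℕ} (u : Fin k → V) :
    unitColumns R (fun i => FlowNode.aux (u i)) = flowRows 0 (unitColumns R u) 0 := by
  ext x j
  rcases x with v | v | v <;> simp [unitColumns, flowRows]

theorem unitColumns_sink [DecidableEq V] {k : ℕ} (u : Fin k → V) :
    unitColumns R (fun i => FlowNode.sink (u i)) = flowRows 0 0 (unitColumns R u) := by
  ext x j
  rcases x with v | v | v <;> simp [unitColumns, flowRows]

/-- A rank function for the flow graph: ranks decrease along directed edges in the observed part
and increase in the sink part. -/
def flowRank (b : V → ℕ) (B : ℕ) : FlowNode V → ℕ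
  | .obs v => 2 * (B - b v)
  | .aux v => 2 * (B - b v) + 1
  | .sink v => 2 * B + 2 + b v

end FlowNodes

/-! ### The parametrization and the kernel description of the ideal -/

section Covariance

theorem dir_of_lambdaMatrix_ne_zero {G : MixedGraph V} {u v : V} (h : G.lambdaMatrix u v ≠ 0) :
    G.dir u v := by
  by_contra hd
  exact h (dif_neg hd)

theorem omegaMatrix_transpose (G : MixedGraph V) : G.omegaMatrixᵀ = G.omegaMatrix := by
  ext u v : 1
  have h : ∀ z z' : Sym2 V, z = z' → ∀ (p : z.IsDiag ∨ z ∈ G.bi.edgeSet)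
      (p' : z'.IsDiag ∨ z' ∈ G.bi.edgeSet), (⟨z, p⟩ : G.BiIndex) = ⟨z', p'⟩ := by
    rintro z _ rfl _ _
    rfl
  by_cases hp : s(u, v).IsDiag ∨ s(u, v) ∈ G.bi.edgeSet
  · have hp' : s(v, u).IsDiag ∨ s(v, u) ∈ G.bi.edgeSet := Sym2.eq_swap (a := u) ▸ hp
    rw [transpose_apply, omegaMatrix, omegaMatrix, dif_pos hp, dif_pos hp',
      h _ _ Sym2.eq_swap hp' hp]
  · have hp' : ¬(s(v, u).IsDiag ∨ s(v, u) ∈ G.bi.edgeSet) := Sym2.eq_swap (a := u) ▸ hp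
    rw [transpose_apply, omegaMatrix, omegaMatrix, dif_neg hp, dif_neg hp']

variable [Fintype V] [DecidableEq V] (G : MixedGraph V)

variable {G} in
theorem IsAcyclic.det_one_sub_lambdaMatrix (hG : G.IsAcyclic) : (1 - G.lambdaMatrix).det = 1 := by
  obtain ⟨b, hb⟩ := hG.exists_rank
  exact det_one_sub_of_rank _ b fun v w h => hb v w (dir_of_lambdaMatrix_ne_zero h)

variable {G} in
theorem IsAcyclic.inv_mul (hG : G.IsAcyclic) :
    (1 - G.lambdaMatrix)⁻¹ * (1 - G.lambdaMatrix) = 1 :=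
  Matrix.nonsing_inv_mul _ (by simp [hG.det_one_sub_lambdaMatrix])

variable {G} in
theorem IsAcyclic.mul_inv (hG : G.IsAcyclic) :
    (1 - G.lambdaMatrix) * (1 - G.lambdaMatrix)⁻¹ = 1 :=
  Matrix.mul_nonsing_inv _ (by simp [hG.det_one_sub_lambdaMatrix])

theorem covariance_transpose : G.covarianceᵀ = G.covariance := by
  simp [covariance, Matrix.transpose_mul, omegaMatrix_transpose, Matrix.mul_assoc]

/-- The homomorphism `ℝ[θ, σ] → ℝ[θ]` that substitutes the parametrization for `σ`. -/
noncomputable def covarianceHom : G.FullRing →ₐ[ℝ] G.ParamRing :=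
  MvPolynomial.aeval (Sum.elim MvPolynomial.X
    (Sym2.lift ⟨G.covariance, fun u v => congrFun (congrFun G.covariance_transpose v) u⟩))

theorem covarianceHom_X_inl (p : G.Param) :
    G.covarianceHom (MvPolynomial.X (Sum.inl p)) = MvPolynomial.X p := by
  simp [covarianceHom]

theorem covarianceHom_sigmaMatrix (u v : V) :
    G.covarianceHom (G.sigmaMatrix u v) = G.covariance u v := by
  simp [covarianceHom, sigmaMatrix]

theorem covarianceHom_rename (f : G.ParamRing) :
    G.covarianceHom (MvPolynomial.rename Sum.inl f) = f := by
  rw [covarianceHom, MvPolynomial.aeval_rename]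
  exact MvPolynomial.aeval_X_left_apply f

/-- Modulo the ideal every $\sigma_{uv}$ equals its image, so the quotient map factors through
`covarianceHom`. -/
theorem mem_graphIdeal_iff (f : G.FullRing) : f ∈ G.graphIdeal ↔ G.covarianceHom f = 0 := by
  constructor
  · intro h
    have hle : G.graphIdeal ≤ RingHom.ker G.covarianceHom := by
      rw [graphIdeal, Ideal.span_le]
      rintro _ ⟨e, rfl⟩
      simp [covarianceHom_sigmaMatrix, covarianceHom_rename]
    exact hle h
  · intro h
    have heq : (Ideal.Quotient.mkₐ ℝ G.graphIdeal).comp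
        ((MvPolynomial.rename Sum.inl).comp G.covarianceHom) =
        Ideal.Quotient.mkₐ ℝ G.graphIdeal := by
      refine MvPolynomial.algHom_ext fun x => ?_
      rcases x with p | z
      · simp [covarianceHom_X_inl]
      · induction z using Sym2.ind with
        | _ u v =>
          have h1 := G.covarianceHom_sigmaMatrix u v
          rw [sigmaMatrix] at h1
          simp only [AlgHom.comp_apply, h1]
          refine ((Ideal.Quotient.mk_eq_mk_iff_sub_mem _ _).2 ?_).symm
          exact Ideal.subset_span ⟨(u, v), rfl⟩
    have h1 := DFunLike.congr_fun heq f
    simp only [AlgHom.comp_apply, h, map_zero] at h1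
    exact Ideal.Quotient.eq_zero_iff_mem.1 h1.symm

/-- The matrix `Λ^id` over `ℝ[θ]`. -/
noncomputable def knownParamLambda (K : Set G.DirEdge) : Matrix V V G.ParamRing :=
  (G.knownLambda K).map G.covarianceHom

open Classical in
theorem knownParamLambda_apply (K : Set G.DirEdge) (u v : V) :
    G.knownParamLambda K u v =
      if ∃ h : G.dir u v, (⟨(u, v), h⟩ : G.DirEdge) ∈ K then G.lambdaMatrix u v else 0 := by
  rw [knownParamLambda, map_apply, knownLambda]
  by_cases h : ∃ h : G.dir u v, (⟨(u, v), h⟩ : G.DirEdge) ∈ K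
  · rw [dif_pos h, if_pos h, covarianceHom_X_inl, lambdaMatrix, dif_pos h.choose]
  · rw [dif_neg h, if_neg h, map_zero]

theorem map_one_sub_knownLambda (K : Set G.DirEdge) :
    (1 - G.knownLambda K).map G.covarianceHom = 1 - G.knownParamLambda K := by
  rw [Matrix.map_sub _ (map_sub _), Matrix.map_one _ (map_zero _) (map_one _), knownParamLambda]

/-- The covariances of the observed and the auxiliary variables with the observed ones. -/
noncomputable def flowCovariance (K : Set G.DirEdge) : Matrix (FlowNode V) V G.ParamRing :=
  flowRows G.covariance ((1 - G.knownParamLambda K)ᵀ * G.covariance) 0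

theorem sigmaMatrix_map : G.sigmaMatrix.map G.covarianceHom = G.covariance := by
  ext u v : 1
  exact G.covarianceHom_sigmaMatrix u v

theorem cutsetMatrix_map (K : Set G.DirEdge) (c : CutsetData V) :
    (G.cutsetMatrix K c).map G.covarianceHom =
      (G.flowCovariance K).submatrix (fun i => (c.src i).node) c.tgt := by
  have h : (((1 - G.knownLambda K)ᵀ * G.sigmaMatrix).map G.covarianceHom) =
      (1 - G.knownParamLambda K)ᵀ * G.covariance := by
    rw [Matrix.map_mul, transpose_map, map_one_sub_knownLambda, sigmaMatrix_map]
  ext i j : 1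
  rw [map_apply, submatrix_apply, cutsetMatrix]
  rcases c.src i with v | v
  · exact G.covarianceHom_sigmaMatrix _ _
  · exact congrFun (congrFun h v) (c.tgt j)

theorem cutsetVector_map (K : Set G.DirEdge) (y : V) (c : CutsetData V) (i : Fin c.k) :
    G.covarianceHom (G.cutsetVector K y c i) =
      (G.flowCovariance K * (1 - G.knownParamLambda K) : Matrix (FlowNode V) V _)
        (c.src i).node y := by
  have h : (G.sigmaMatrix * (1 - G.knownLambda K)).map G.covarianceHom =
      G.covariance * (1 - G.knownParamLambda K) := by
    rw [Matrix.map_mul, map_one_sub_knownLambda, sigmaMatrix_map]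
  have h' : ((1 - G.knownLambda K)ᵀ * G.sigmaMatrix * (1 - G.knownLambda K)).map G.covarianceHom =
      (1 - G.knownParamLambda K)ᵀ * G.covariance * (1 - G.knownParamLambda K) := by
    rw [Matrix.map_mul, Matrix.map_mul, transpose_map, map_one_sub_knownLambda, sigmaMatrix_map]
  rw [flowCovariance, flowRows_mul, cutsetVector]
  rcases c.src i with v | v
  · exact congrFun (congrFun h v) y
  · exact congrFun (congrFun h' v) y

end Covariance

end MixedGraph

/-! ### Vanishing of the cutset polynomial -/

namespace MixedGraph

open Matrix

variable {V : Type*} {G : MixedGraph V}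

theorem AuxFlowEdge.rank_lt {K : Set G.DirEdge} {b : V → ℕ} {B : ℕ}
    (hb : ∀ u v, G.dir u v → b u < b v) (hB : ∀ v, b v ≤ B) {x y : FlowNode V}
    (h : G.AuxFlowEdge K x y) : flowRank b B x < flowRank b B y := by
  cases h with
  | @known u v h _ => have := hb _ _ h; have := hB v; simp only [flowRank]; omega
  | @unknown u v h _ => have := hb _ _ h; have := hB v; simp only [flowRank]; omega
  | obs_aux v => simp only [flowRank]; omega
  | aux_sink v => simp only [flowRank]; omega
  | @bidirected u v _ => simp only [flowRank]; omega
  | @sink_sink u v h => have := hb _ _ h; simp only [flowRank]; omega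

theorem IsAcyclic.exists_flowRank [Finite V] (hG : G.IsAcyclic) (K : Set G.DirEdge) :
    ∃ r : FlowNode V → ℕ, ∀ x y, G.AuxFlowEdge K x y → r x < r y := by
  obtain ⟨b, hb⟩ := hG.exists_rank
  obtain ⟨B, hB⟩ := (Set.finite_range b).bddAbove
  exact ⟨flowRank b B, fun x y h => h.rank_lt hb fun v => hB ⟨v, rfl⟩⟩

theorem eq_or_adj_of_omegaMatrix_ne_zero {u v : V} (h : G.omegaMatrix u v ≠ 0) :
    u = v ∨ G.bi.Adj u v := by
  by_contra hd
  refine h (dif_neg ?_)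
  simpa using hd

variable [Fintype V] [DecidableEq V]

theorem knownParamLambda_ne_zero {K : Set G.DirEdge} {u v : V}
    (h : G.knownParamLambda K u v ≠ 0) : ∃ h : G.dir u v, (⟨(u, v), h⟩ : G.DirEdge) ∈ K := by
  by_contra hd
  rw [knownParamLambda_apply, if_neg hd] at h
  exact h rfl

theorem lambdaMatrix_sub_knownParamLambda_ne_zero {K : Set G.DirEdge} {u v : V}
    (h : (G.lambdaMatrix - G.knownParamLambda K) u v ≠ 0) :
    ∃ h : G.dir u v, (⟨(u, v), h⟩ : G.DirEdge) ∉ K := by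
  rw [Matrix.sub_apply, knownParamLambda_apply] at h
  split_ifs at h with hK
  · simp at h
  · have hd := dir_of_lambdaMatrix_ne_zero (by simpa using h)
    exact ⟨hd, fun hm => hK ⟨hd, hm⟩⟩

theorem flowCovariance_eq (hG : G.IsAcyclic) (K : Set G.DirEdge) :
    G.flowCovariance K * (1 - G.lambdaMatrix) =
      flowRows ((1 - G.lambdaMatrix)⁻¹ᵀ * G.omegaMatrix)
        ((1 - G.knownParamLambda K)ᵀ * ((1 - G.lambdaMatrix)⁻¹ᵀ * G.omegaMatrix)) 0 := by
  rw [flowCovariance, flowRows_mul, covariance]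
  simp only [Matrix.mul_assoc, hG.inv_mul, Matrix.mul_one, Matrix.zero_mul]

/-- The column of the coefficients of the edge `e` and of the known edges into the head of `e`. -/
noncomputable def removedColumn (G : MixedGraph V) (K : Set G.DirEdge) (e : G.DirEdge) :
    V → G.ParamRing :=
  fun p => G.knownParamLambda K p e.1.2 +
    if p = e.1.1 then MvPolynomial.X (Sum.inl e) else 0

/-- The matrix `Λ` without the edge `e` and the known edges into the head of `e`. -/
noncomputable def reducedLambda (G : MixedGraph V) (K : Set G.DirEdge) (e : G.DirEdge) :
    Matrix V V G.ParamRing :=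
  G.lambdaMatrix - vecMulVec (G.removedColumn K e) (Pi.single e.1.2 1)

theorem reducedLambda_ne_zero {K : Set G.DirEdge} {e : G.DirEdge} (he : e ∉ K) {p q : V}
    (h : G.reducedLambda K e p q ≠ 0) :
    G.dir p q ∧ ¬ ∃ f : G.DirEdge, (f = e ∨ f ∈ K) ∧ f.1.2 = e.1.2 ∧ p = f.1.1 ∧ q = f.1.2 := by
  obtain ⟨⟨x, y⟩, hxy⟩ := e
  simp only [reducedLambda, removedColumn, Matrix.sub_apply, vecMulVec_apply, Pi.single_apply] at h
  by_cases hq : q = y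
  · subst hq
    rw [if_pos rfl, mul_one, knownParamLambda_apply] at h
    by_cases hp : p = x
    · subst hp
      rw [if_neg (by rintro ⟨_, hK⟩; exact he hK), if_pos rfl, lambdaMatrix, dif_pos hxy] at h
      simp at h
    · rw [if_neg hp, add_zero] at h
      split_ifs at h with hK
      · simp at h
      · rw [sub_zero] at h
        refine ⟨dir_of_lambdaMatrix_ne_zero h, ?_⟩
        rintro ⟨⟨⟨p', q'⟩, hf⟩, hfe | hfK, h1, h2, h3⟩
        · exact hp (h2.trans (congrArg (fun f : G.DirEdge => f.1.1) hfe))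
        · dsimp only at h2 h3
          subst h2 h3
          exact hK ⟨hf, hfK⟩
  · rw [if_neg hq, mul_zero, sub_zero] at h
    refine ⟨dir_of_lambdaMatrix_ne_zero h, ?_⟩
    rintro ⟨f, -, h1, -, h3⟩
    exact hq (h3.trans h1)

/-- Ordered by rank, `1 - W` is unitriangular, hence so is its inverse. -/
theorem inv_apply_of_rank {R : Type*} [CommRing R] {W : Matrix V V R} {b : V → ℕ}
    (hb : ∀ v w, W v w ≠ 0 → b v < b w) :
    (∀ v w, b w < b v → (1 - W)⁻¹ v w = 0) ∧ ∀ v, (1 - W)⁻¹ v v = 1 := by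
  have hu : IsUnit (1 - W).det := by simp [det_one_sub_of_rank W b hb]
  have ht : BlockTriangular (1 - W) b := by
    intro v w h
    have hvw : v ≠ w := by rintro rfl; exact lt_irrefl _ h
    rw [Matrix.sub_apply, one_apply_ne hvw, zero_sub, neg_eq_zero]
    by_contra h0
    exact lt_asymm h (hb _ _ h0)
  have := Matrix.invertibleOfIsUnitDet _ hu
  have h1 : ∀ v w, b w < b v → (1 - W)⁻¹ v w = 0 := fun v w h =>
    blockTriangular_inv_of_blockTriangular ht h
  refine ⟨h1, fun v => ?_⟩
  have h2 := congrFun (congrFun (Matrix.nonsing_inv_mul _ hu) v) v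
  rw [Matrix.mul_sub, Matrix.mul_one, Matrix.sub_apply, Matrix.mul_apply,
    Finset.sum_eq_zero, sub_zero, one_apply_eq] at h2
  · exact h2
  · intro p _
    by_cases hp : W p v = 0
    · rw [hp, mul_zero]
    · rw [h1 v p (hb _ _ hp), zero_mul]

theorem reducedFlowEdge_of_flowWeight_ne_zero {K : Set G.DirEdge} {e : G.DirEdge} (he : e ∉ K)
    {x y : FlowNode V}
    (h : flowWeight (G.knownParamLambda K)ᵀ (G.lambdaMatrix - G.knownParamLambda K)ᵀ G.omegaMatrix
      (G.reducedLambda K e) x y ≠ 0) : G.ReducedFlowEdge K e x y := by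
  have hns : ∀ {x y : FlowNode V}, (∀ v, x ≠ .sink v) → G.AuxFlowEdge K x y →
      G.ReducedFlowEdge K e x y := fun hx hxy => ⟨hxy, fun ⟨f, _, _, hf, _⟩ => hx _ hf⟩
  rcases x with v | v | v <;> rcases y with w | w | w <;>
    simp only [flowWeight, transpose_apply, ne_eq, not_true_eq_false] at h
  · obtain ⟨hd, hK⟩ := knownParamLambda_ne_zero h
    exact hns (by simp) (.known hd hK)
  · by_cases hvw : v = w
    · subst hvw
      exact hns (by simp) (.obs_aux v)
    · exact absurd (if_neg hvw) h
  · obtain ⟨hd, hK⟩ := lambdaMatrix_sub_knownParamLambda_ne_zero h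
    exact hns (by simp) (.unknown hd hK)
  · refine hns (by simp) ?_
    rcases eq_or_adj_of_omegaMatrix_ne_zero h with rfl | hvw
    · exact .aux_sink v
    · exact .bidirected hvw
  · obtain ⟨hd, hn⟩ := reducedLambda_ne_zero he h
    refine ⟨.sink_sink hd, ?_⟩
    rintro ⟨f, h1, h2, h3, h4⟩
    exact hn ⟨f, h1, h2, FlowNode.sink.inj h3, FlowNode.sink.inj h4⟩

/-- The entries are the path generating functions of the reduced flow graph, weighted by $\Lambda$
and $\Omega$ with `reducedLambda` on the sink copies. A nonzero determinant would produce a full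
flow. -/
theorem det_reduced_eq_zero (hG : G.IsAcyclic) {K : Set G.DirEdge} {e : G.DirEdge} (he : e ∉ K)
    {k : ℕ} {src : Fin k → Source V} {tgt : Fin k → V}
    (hflow : ¬ HasFullFlow (G.ReducedFlowEdge K e) (fun i => (src i).node)
      (fun j => FlowNode.sink (tgt j))) :
    (((G.flowCovariance K * (1 - G.lambdaMatrix)) * (1 - G.reducedLambda K e)⁻¹ :
      Matrix (FlowNode V) V _).submatrix (fun i => (src i).node) tgt).det = 0 := by
  obtain ⟨b, hb⟩ := hG.exists_rank
  obtain ⟨r, hr⟩ := hG.exists_flowRank K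
  have hred : ∀ v w, G.reducedLambda K e v w ≠ 0 → b v < b w := fun v w h =>
    hb v w (reducedLambda_ne_zero he h).1
  have hu : IsUnit (1 - G.reducedLambda K e).det := by simp [det_one_sub_of_rank _ b hred]
  set Λ := G.lambdaMatrix
  set Λ' := G.knownParamLambda K
  set H := (1 - Λ)⁻¹
  set S := (1 - G.reducedLambda K e)⁻¹ * unitColumns G.ParamRing tgt with hS
  set X := Hᵀ * G.omegaMatrix * S with hX
  have h1 : (1 - Λ)ᵀ * X = G.omegaMatrix * S := by
    rw [hX, Matrix.mul_assoc, ← Matrix.mul_assoc, ← transpose_mul, hG.inv_mul, transpose_one,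
      Matrix.one_mul]
  have h2 : (1 - G.reducedLambda K e) * S = unitColumns _ tgt := by
    rw [hS, ← Matrix.mul_assoc, Matrix.mul_nonsing_inv _ hu, Matrix.one_mul]
  by_contra hdet
  refine hflow (HasFullFlow.mono (fun v w h => reducedFlowEdge_of_flowWeight_ne_zero he h)
    (hasFullFlow_of_det_ne_zero _ r
      (fun v w h => hr v w (reducedFlowEdge_of_flowWeight_ne_zero he h).1) _ _
      (flowRows X ((1 - Λ')ᵀ * X) S) ?_ ?_))
  · rw [one_sub_flowWeight_mul, unitColumns_sink]
    congr 1
    · rw [transpose_sub, transpose_one, Matrix.sub_mul, Matrix.one_mul, sub_self]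
    · rw [← h1, ← Matrix.sub_mul, ← Matrix.sub_mul, ← transpose_sub, ← transpose_sub,
        show 1 - Λ' - (Λ - Λ') - (1 - Λ) = 0 by abel, transpose_zero, Matrix.zero_mul]
    · rw [← h2, Matrix.sub_mul, Matrix.one_mul]
  · convert hdet using 2
    rw [flowCovariance_eq hG, flowRows_mul]
    ext i j : 1
    rw [submatrix_apply, submatrix_apply]
    rcases src i with v | v
    · change X v j = _
      rw [hX, hS, ← Matrix.mul_assoc, mul_unitColumns]
      rfl
    · change ((1 - Λ')ᵀ * X : Matrix V (Fin k) G.ParamRing) v j = _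
      rw [hX, hS, ← Matrix.mul_assoc, ← Matrix.mul_assoc, mul_unitColumns]
      rfl

/-- The rank one change of $\Lambda$ subtracts from the matrix a multiple of row $y$ of
$(1-\Lambda_{\mathrm{red}})^{-1}$. By acyclicity that row is zero at the parents of $y$ and one at
$y$. -/
theorem reduced_apply (hG : G.IsAcyclic) {K : Set G.DirEdge} {e : G.DirEdge} (he : e ∉ K)
    (x : FlowNode V) :
    (∀ t, G.dir t e.1.2 →
      ((G.flowCovariance K * (1 - G.lambdaMatrix)) * (1 - G.reducedLambda K e)⁻¹ :
        Matrix (FlowNode V) V _) x t = G.flowCovariance K x t) ∧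
    ((G.flowCovariance K * (1 - G.lambdaMatrix)) * (1 - G.reducedLambda K e)⁻¹ :
        Matrix (FlowNode V) V _) x e.1.2 =
      (G.flowCovariance K * (1 - G.knownParamLambda K) : Matrix (FlowNode V) V _) x e.1.2 -
        MvPolynomial.X (Sum.inl e) * G.flowCovariance K x e.1.1 := by
  obtain ⟨b, hb⟩ := hG.exists_rank
  have hred : ∀ v w, G.reducedLambda K e v w ≠ 0 → b v < b w := fun v w h =>
    hb v w (reducedLambda_ne_zero he h).1
  have hu : IsUnit (1 - G.reducedLambda K e).det := by simp [det_one_sub_of_rank _ b hred]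
  obtain ⟨hz, hone⟩ := inv_apply_of_rank hred
  set M := G.flowCovariance K
  have key : M * (1 - G.lambdaMatrix) * (1 - G.reducedLambda K e)⁻¹ =
      M - vecMulVec (M *ᵥ G.removedColumn K e)
        (Pi.single e.1.2 1 ᵥ* (1 - G.reducedLambda K e)⁻¹) := by
    have h1 : 1 - G.lambdaMatrix = 1 - G.reducedLambda K e -
        vecMulVec (G.removedColumn K e) (Pi.single e.1.2 1) := by
      rw [reducedLambda]
      abel
    rw [h1, Matrix.mul_assoc, Matrix.sub_mul _ _ (1 - G.reducedLambda K e)⁻¹,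
      Matrix.mul_nonsing_inv _ hu, Matrix.mul_sub, Matrix.mul_one, vecMulVec_mul, mul_vecMulVec]
  rw [key]
  simp only [Matrix.sub_apply, vecMulVec_apply, single_one_vecMul, row_apply]
  refine ⟨fun t ht => by rw [hz _ _ (hb _ _ ht), mul_zero, sub_zero], ?_⟩
  rw [hone, mul_one, Matrix.mul_sub, Matrix.mul_one, Matrix.sub_apply, Matrix.mul_apply]
  simp only [mulVec, dotProduct, removedColumn, mul_add, Finset.sum_add_distrib, mul_ite, mul_zero,
    Finset.sum_ite_eq', Finset.mem_univ, if_true]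
  ring

theorem covarianceHom_cutsetPolynomial (hG : G.IsAcyclic) {K : Set G.DirEdge} {e : G.DirEdge}
    {c : CutsetData V} (hc : G.IsInstrumentalCutset K e c) :
    G.covarianceHom (G.cutsetPolynomial K e c) = 0 := by
  have hdet := det_reduced_eq_zero hG hc.not_known hc.no_flow
  set A := (G.flowCovariance K).submatrix (fun i => (c.src i).node) c.tgt with hA
  have hB : ((G.flowCovariance K * (1 - G.lambdaMatrix)) * (1 - G.reducedLambda K e)⁻¹ :
      Matrix (FlowNode V) V _).submatrix (fun i => (c.src i).node)
        (fun j => Function.update c.tgt c.col e.1.2 j) =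
      A.updateCol c.col (fun i => G.covarianceHom (G.cutsetVector K e.1.2 c i) +
        (-MvPolynomial.X (Sum.inl e)) * A i c.col) := by
    ext i j : 1
    rw [submatrix_apply]
    by_cases hj : j = c.col
    · subst hj
      rw [Function.update_self, (reduced_apply hG hc.not_known _).2, updateCol_self,
        cutsetVector_map, hA, submatrix_apply, hc.tgt_col]
      ring
    · rw [Function.update_of_ne hj, (reduced_apply hG hc.not_known _).1 _ (hc.tgt_parent j),
        updateCol_ne hj, hA, submatrix_apply]
  have hsplit : A.updateCol c.col (fun i => G.covarianceHom (G.cutsetVector K e.1.2 c i) +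
        (-MvPolynomial.X (Sum.inl e)) * A i c.col) =
      A.updateCol c.col ((fun i => G.covarianceHom (G.cutsetVector K e.1.2 c i)) +
        (-MvPolynomial.X (Sum.inl e) : G.ParamRing) • fun i => A i c.col) := rfl
  rw [hB, hsplit, det_updateCol_add, det_updateCol_smul, updateCol_eq_self] at hdet
  rw [cutsetPolynomial, map_sub, map_mul, covarianceHom_X_inl, AlgHom.map_det, AlgHom.map_det,
    AlgHom.mapMatrix_apply, AlgHom.mapMatrix_apply, map_updateCol, cutsetMatrix_map]
  have hcomp : (G.covarianceHom ∘ G.cutsetVector K e.1.2 c) =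
      fun i => G.covarianceHom (G.cutsetVector K e.1.2 c i) := rfl
  rw [hcomp, ← hA]
  linear_combination -hdet

end MixedGraph

/-! ### Nonvanishing of $\det A$ -/

namespace MixedGraph

open Matrix

variable {V : Type*} {G : MixedGraph V}

open Classical in
/-- The labelling of the part of the flow graph that avoids the sink copies. -/
noncomputable def leftLabel (G : MixedGraph V) (K : Set G.DirEdge) :
    FlowNode V → FlowNode V → Option (Option G.Param)
  | .obs v, .obs u =>
    if h : ∃ h : G.dir u v, (⟨(u, v), h⟩ : G.DirEdge) ∈ K then
      some (some (.inl ⟨(u, v), h.choose⟩)) else none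
  | .obs v, .aux w => if v = w then some none else none
  | .aux v, .obs u =>
    if h : ∃ h : G.dir u v, (⟨(u, v), h⟩ : G.DirEdge) ∉ K then
      some (some (.inl ⟨(u, v), h.choose⟩)) else none
  | _, _ => none

open Classical in
/-- The labelling of the part of the flow graph on the sink copies, together with the edges from
the observed to the auxiliary variables. -/
noncomputable def rightLabel (G : MixedGraph V) :
    FlowNode V → FlowNode V → Option (Option G.Param)
  -- No path on the sink copies uses these edges; they are kept because `flowWeight` always contains
  -- them.
  | .obs v, .aux w => if v = w then some none else none
  | .sink u, .sink v => if h : G.dir u v then some (some (.inl ⟨(u, v), h⟩)) else none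
  | _, _ => none

theorem auxFlowEdge_of_leftLabel {K : Set G.DirEdge} {x y : FlowNode V}
    (h : G.leftLabel K x y ≠ none) : G.AuxFlowEdge K x y := by
  rcases x with v | v | v <;> rcases y with w | w | w <;>
    simp only [leftLabel, ne_eq, not_true_eq_false] at h
  · by_cases hK : ∃ h : G.dir w v, (⟨(w, v), h⟩ : G.DirEdge) ∈ K
    · exact .known hK.choose hK.choose_spec
    · exact absurd (dif_neg hK) h
  · by_cases hvw : v = w
    · subst hvw
      exact .obs_aux v
    · exact absurd (if_neg hvw) h
  · by_cases hK : ∃ h : G.dir w v, (⟨(w, v), h⟩ : G.DirEdge) ∉ K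
    · exact .unknown hK.choose hK.choose_spec
    · exact absurd (dif_neg hK) h

theorem auxFlowEdge_of_rightLabel {K : Set G.DirEdge} {x y : FlowNode V}
    (h : G.rightLabel x y ≠ none) : G.AuxFlowEdge K x y := by
  rcases x with v | v | v <;> rcases y with w | w | w <;>
    simp only [rightLabel, ne_eq, not_true_eq_false] at h
  · by_cases hvw : v = w
    · subst hvw
      exact .obs_aux v
    · exact absurd (if_neg hvw) h
  · by_cases hd : G.dir v w
    · exact .sink_sink hd
    · exact absurd (dif_neg hd) h

theorem leftLabel_eq_some {K : Set G.DirEdge} {x y : FlowNode V} {e : G.Param}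
    (h : G.leftLabel K x y = some (some e)) :
    ∃ u v, ∃ hd : G.dir u v, e = .inl ⟨(u, v), hd⟩ ∧ y = .obs u ∧
      ((⟨(u, v), hd⟩ : G.DirEdge) ∈ K ∧ x = .obs v ∨
        (⟨(u, v), hd⟩ : G.DirEdge) ∉ K ∧ x = .aux v) := by
  rcases x with v | v | v <;> rcases y with w | w | w <;>
    simp only [leftLabel, reduceCtorEq] at h
  · split_ifs at h with hK
    simp only [Option.some.injEq] at h
    exact ⟨w, v, hK.choose, h.symm, rfl, .inl ⟨hK.choose_spec, rfl⟩⟩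
  · split_ifs at h
    cases h
  · split_ifs at h with hK
    simp only [Option.some.injEq] at h
    exact ⟨w, v, hK.choose, h.symm, rfl, .inr ⟨hK.choose_spec, rfl⟩⟩

theorem leftLabel_injective {K : Set G.DirEdge} {x y x' y' : FlowNode V} {e : G.Param}
    (h : G.leftLabel K x y = some (some e)) (h' : G.leftLabel K x' y' = some (some e)) :
    x = x' ∧ y = y' := by
  obtain ⟨u, v, hd, rfl, rfl, hx⟩ := leftLabel_eq_some h
  obtain ⟨u', v', hd', he, rfl, hx'⟩ := leftLabel_eq_some h'
  simp only [Sum.inl.injEq, Subtype.mk.injEq, Prod.mk.injEq] at he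
  obtain ⟨rfl, rfl⟩ := he
  refine ⟨?_, rfl⟩
  rcases hx with ⟨hK, rfl⟩ | ⟨hK, rfl⟩ <;> rcases hx' with ⟨hK', rfl⟩ | ⟨hK', rfl⟩
  · rfl
  · exact absurd hK hK'
  · exact absurd hK' hK
  · rfl

theorem leftLabel_eq_some_none {K : Set G.DirEdge} {x y : FlowNode V}
    (h : G.leftLabel K x y = some none) : ∃ v, x = .obs v ∧ y = .aux v := by
  rcases x with v | v | v <;> rcases y with w | w | w <;>
    simp only [leftLabel, reduceCtorEq] at h
  · split_ifs at h
    cases h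
  · split_ifs at h with hvw
    exact ⟨v, rfl, by rw [hvw]⟩
  · split_ifs at h
    cases h

theorem rightLabel_injective {x y x' y' : FlowNode V} {e : G.Param}
    (h : G.rightLabel x y = some (some e)) (h' : G.rightLabel x' y' = some (some e)) :
    x = x' ∧ y = y' := by
  have aux : ∀ {x y : FlowNode V}, G.rightLabel x y = some (some e) →
      ∃ u v, ∃ hd : G.dir u v, e = .inl ⟨(u, v), hd⟩ ∧ x = .sink u ∧ y = .sink v := by
    intro x y h
    rcases x with v | v | v <;> rcases y with w | w | w <;>
      simp only [rightLabel, reduceCtorEq] at h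
    · split_ifs at h
      cases h
    · split_ifs at h with hd
      simp only [Option.some.injEq] at h
      exact ⟨v, w, hd, h.symm, rfl, rfl⟩
  obtain ⟨u, v, hd, rfl, rfl, rfl⟩ := aux h
  obtain ⟨u', v', hd', he, rfl, rfl⟩ := aux h'
  simp only [Sum.inl.injEq, Subtype.mk.injEq, Prod.mk.injEq] at he
  exact ⟨congrArg _ he.1, congrArg _ he.2⟩

theorem rightLabel_eq_some_none {x y : FlowNode V}
    (h : G.rightLabel x y = some none) : ∃ v, x = .obs v ∧ y = .aux v := by
  rcases x with v | v | v <;> rcases y with w | w | w <;>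
    simp only [rightLabel, reduceCtorEq] at h
  · split_ifs at h with hvw
    exact ⟨v, rfl, by rw [hvw]⟩
  · split_ifs at h
    cases h

/-- A path in the flow graph that ends in a sink copy and does not start in one splits into a path
avoiding the sink copies and a path on the sink copies. -/
theorem exists_path_split {K : Set G.DirEdge} {t : V} :
    ∀ {p : List (FlowNode V)} {a : FlowNode V}, p.IsChain (G.AuxFlowEdge K) → p.head? = some a →
      p.getLast? = some (.sink t) →
      ((∃ w, a = .sink w) ∧ p.IsChain (fun x y => G.rightLabel x y ≠ none)) ∨
      (∀ w, a ≠ .sink w) ∧ ∃ (L M : List (FlowNode V)) (u v : V), p = L ++ M ∧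
        L.IsChain (fun x y => G.leftLabel K x y ≠ none) ∧ L.head? = some a ∧
        L.getLast? = some (.aux u) ∧ M.IsChain (fun x y => G.rightLabel x y ≠ none) ∧
        M.head? = some (.sink v) ∧ M.getLast? = some (.sink t) ∧ (u = v ∨ G.bi.Adj u v)
  | [], _, _, h, _ => by simp at h
  | [c], a, _, h, hl => by
    simp only [List.head?_cons, List.getLast?_singleton, Option.some.injEq] at h hl
    subst h
    exact .inl ⟨⟨t, hl⟩, by simp⟩
  | c :: d :: l, a, hc, h, hl => by
    simp only [List.head?_cons, Option.some.injEq] at h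
    subst h
    rw [List.isChain_cons_cons] at hc
    have hl' : (d :: l).getLast? = some (.sink t) := by simpa using hl
    rcases exists_path_split hc.2 rfl hl' with ⟨⟨w, rfl⟩, hr⟩ |
      ⟨hd, L, M, u, v, hLM, hL, hLh, hLl, hM, hMh, hMl, huv⟩
    · have hcross : ∀ u, c = .aux u → (u = w ∨ G.bi.Adj u w) →
          (∀ w, c ≠ .sink w) ∧ ∃ (L M : List (FlowNode V)) (u v : V),
            c :: FlowNode.sink w :: l = L ++ M ∧
            L.IsChain (fun x y => G.leftLabel K x y ≠ none) ∧ L.head? = some c ∧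
            L.getLast? = some (.aux u) ∧ M.IsChain (fun x y => G.rightLabel x y ≠ none) ∧
            M.head? = some (.sink v) ∧ M.getLast? = some (.sink t) ∧ (u = v ∨ G.bi.Adj u v) := by
        rintro u rfl hu
        exact ⟨by simp, [.aux u], _, u, w, rfl, by simp, rfl, rfl, hr, rfl, hl', hu⟩
      cases hc.1 with
      | aux_sink v => exact .inr (hcross _ rfl (.inl rfl))
      | bidirected h => exact .inr (hcross _ rfl (.inr h))
      | @sink_sink u _ h =>
        refine .inl ⟨⟨u, rfl⟩, ?_⟩
        rw [List.isChain_cons_cons]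
        exact ⟨by simp [rightLabel, h], hr⟩
    · right
      have hcd : G.leftLabel K c d ≠ none ∧ ∀ w, c ≠ .sink w := by
        cases hc.1 with
        | @known u v h hK => exact ⟨by simp [leftLabel, h, hK], by simp⟩
        | @unknown u v h hK => exact ⟨by simp [leftLabel, h, hK], by simp⟩
        | obs_aux v => exact ⟨by simp [leftLabel], by simp⟩
        | aux_sink v => exact absurd rfl (hd v)
        | bidirected h => exact absurd rfl (hd _)
        | sink_sink h => exact absurd rfl (hd _)
      refine ⟨hcd.2, c :: L, M, u, v, by rw [hLM]; rfl, ?_, rfl, ?_, hM, hMh, hMl, huv⟩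
      · rw [List.isChain_cons]
        refine ⟨fun y hy => ?_, hL⟩
        rw [hLh] at hy
        simp only [Option.mem_def, Option.some.injEq] at hy
        exact hy ▸ hcd.1
      · simp [List.getLast?_cons, hLl]

theorem labelWeight_rightLabel [DecidableEq V] :
    labelWeight G.rightLabel = flowWeight 0 0 0 G.lambdaMatrix := by
  ext x y : 1
  rcases x with v | v | v <;> rcases y with w | w | w <;> try rfl
  · simp only [labelWeight, rightLabel, flowWeight]
    by_cases hvw : v = w
    · rw [if_pos hvw, if_pos hvw]
    · rw [if_neg hvw, if_neg hvw]
  · simp only [labelWeight, rightLabel, flowWeight, lambdaMatrix]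
    by_cases hd : G.dir v w
    · rw [dif_pos hd, dif_pos hd]
    · rw [dif_neg hd, dif_neg hd]

/-- The specialization `Ω = C Cᵀ` for a matrix `C` with entries in `ℝ[θ][t]`. -/
noncomputable def gramSpecialization (G : MixedGraph V) {k : ℕ}
    (C : Matrix V (Fin k) (Polynomial G.ParamRing)) : G.ParamRing →+* Polynomial G.ParamRing :=
  MvPolynomial.eval₂Hom (algebraMap ℝ (Polynomial G.ParamRing)) (Sum.elim
    (fun e => Polynomial.C (MvPolynomial.X (Sum.inl e)))
    (fun z => Sym2.lift ⟨fun u v => (C * Cᵀ) u v, fun u v => by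
      simp only [Matrix.mul_apply, transpose_apply, mul_comm]⟩ z.1))

theorem gramSpecialization_omegaMatrix {k : ℕ} {C : Matrix V (Fin k) (Polynomial G.ParamRing)}
    (hC : ∀ u v, u ≠ v → ¬ G.bi.Adj u v → (C * Cᵀ) u v = 0) :
    G.omegaMatrix.map (G.gramSpecialization C) = C * Cᵀ := by
  ext u v : 1
  rw [map_apply, omegaMatrix]
  by_cases h : s(u, v).IsDiag ∨ s(u, v) ∈ G.bi.edgeSet
  · rw [dif_pos h, gramSpecialization, MvPolynomial.coe_eval₂Hom, MvPolynomial.eval₂_X]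
    rfl
  · rw [dif_neg h, map_zero]
    simp only [Sym2.mk_isDiag_iff, SimpleGraph.mem_edgeSet, not_or] at h
    exact (hC u v h.1 h.2).symm

theorem gramSpecialization_lambdaMatrix {k : ℕ} (C : Matrix V (Fin k) (Polynomial G.ParamRing))
    (u v : V) :
    G.gramSpecialization C (G.lambdaMatrix u v) = Polynomial.C (G.lambdaMatrix u v) := by
  rw [lambdaMatrix]
  split_ifs with h
  · rw [gramSpecialization, MvPolynomial.coe_eval₂Hom, MvPolynomial.eval₂_X]
    rfl
  · simp

theorem map_C_map_evalRingHom {R : Type*} [CommRing R] (a : R) {m n : Type*} (A : Matrix m n R) :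
    (A.map (Polynomial.C : R →+* _)).map (Polynomial.evalRingHom a) = A := by
  ext i j : 1
  simp

variable [Fintype V] [DecidableEq V]

theorem labelWeight_leftLabel (K : Set G.DirEdge) :
    labelWeight (G.leftLabel K) = flowWeight (G.knownParamLambda K)ᵀ
      (G.lambdaMatrix - G.knownParamLambda K)ᵀ 0 0 := by
  ext x y : 1
  rcases x with v | v | v <;> rcases y with w | w | w <;> try rfl
  · simp only [labelWeight, leftLabel, flowWeight, transpose_apply, knownParamLambda_apply]
    by_cases hK : ∃ h : G.dir w v, (⟨(w, v), h⟩ : G.DirEdge) ∈ K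
    · rw [dif_pos hK, if_pos hK, lambdaMatrix, dif_pos hK.choose]
    · rw [dif_neg hK, if_neg hK]
  · simp only [labelWeight, leftLabel, flowWeight]
    by_cases hvw : v = w
    · rw [if_pos hvw, if_pos hvw]
    · rw [if_neg hvw, if_neg hvw]
  · simp only [labelWeight, leftLabel, flowWeight, transpose_apply, Matrix.sub_apply,
      knownParamLambda_apply]
    by_cases hK : ∃ h : G.dir w v, (⟨(w, v), h⟩ : G.DirEdge) ∉ K
    · rw [dif_pos hK, if_neg (fun h => hK.choose_spec h.choose_spec), lambdaMatrix,
        dif_pos hK.choose, sub_zero]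
    · rw [dif_neg hK]
      by_cases hd : G.dir w v
      · rw [if_pos ⟨hd, by_contra fun h => hK ⟨hd, h⟩⟩, sub_self]
      · rw [if_neg (fun h => hd h.choose), lambdaMatrix, dif_neg hd, sub_zero]

/-- The path generating functions of the part of the flow graph that avoids the sink copies. -/
noncomputable def leftFlow (G : MixedGraph V) (K : Set G.DirEdge) :
    Matrix (FlowNode V) V G.ParamRing :=
  flowRows (1 - G.lambdaMatrix)⁻¹ᵀ ((1 - G.knownParamLambda K)ᵀ * (1 - G.lambdaMatrix)⁻¹ᵀ) 0

theorem flowCovariance_eq_leftFlow (K : Set G.DirEdge) :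
    G.flowCovariance K = G.leftFlow K * G.omegaMatrix * (1 - G.lambdaMatrix)⁻¹ := by
  rw [flowCovariance, leftFlow, flowRows_mul, flowRows_mul, covariance]
  simp only [Matrix.mul_assoc, Matrix.zero_mul]

/-- Outside the sink copies, $\lambda_{uv}$ labels exactly one edge, starting at $v$ or at $v^*$
according to whether it is known. The unlabelled edges $v\to v^*$ leave the observed nodes, which
serve as `O`. -/
theorem det_leftFlow_ne_zero (hG : G.IsAcyclic) {K : Set G.DirEdge} {k : ℕ}
    {src : Fin k → FlowNode V} {u : Fin k → V} {path : Fin k → List (FlowNode V)}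
    (hp : ∀ i, (path i).IsChain (fun x y => G.leftLabel K x y ≠ none) ∧
      (path i).head? = some (src i) ∧ (path i).getLast? = some (.aux (u i)))
    (hd : ∀ i j, i ≠ j → (path i).Disjoint (path j)) :
    ((G.leftFlow K).submatrix src u).det ≠ 0 := by
  obtain ⟨r, hr⟩ := hG.exists_flowRank K
  refine det_submatrix_ne_zero_of_paths (O := Set.range FlowNode.obs)
    (fun v w h => hr v w (auxFlowEdge_of_leftLabel h)) leftLabel_injective ?_ ?_ hp hd
    ((G.leftFlow K).submatrix id u) ?_
  · intro v w h
    obtain ⟨x, rfl, rfl⟩ := leftLabel_eq_some_none h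
    simp
  · intro v w w' h h'
    obtain ⟨x, rfl, rfl⟩ := leftLabel_eq_some_none h
    obtain ⟨x', hx, rfl⟩ := leftLabel_eq_some_none h'
    rw [FlowNode.obs.inj hx]
  · rw [← mul_unitColumns, labelWeight_leftLabel, leftFlow, flowRows_mul, one_sub_flowWeight_mul,
      unitColumns_aux]
    have h1 : (1 - G.lambdaMatrix)ᵀ * (1 - G.lambdaMatrix)⁻¹ᵀ = 1 := by
      rw [← transpose_mul, hG.inv_mul, transpose_one]
    congr 1
    · rw [transpose_sub, transpose_one, Matrix.sub_mul, Matrix.one_mul, Matrix.sub_mul,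
        Matrix.mul_assoc, sub_self]
    · rw [Matrix.zero_mul, sub_zero, Matrix.mul_assoc, ← Matrix.sub_mul,
        ← transpose_sub, show 1 - G.knownParamLambda K - (G.lambdaMatrix - G.knownParamLambda K) =
          1 - G.lambdaMatrix by abel, ← Matrix.mul_assoc, h1, Matrix.one_mul]
    · simp

theorem det_inv_submatrix_ne_zero (hG : G.IsAcyclic) {k : ℕ}
    {v t : Fin k → V} {path : Fin k → List (FlowNode V)}
    (hp : ∀ i, (path i).IsChain (fun x y => G.rightLabel x y ≠ none) ∧
      (path i).head? = some (.sink (v i)) ∧ (path i).getLast? = some (.sink (t i)))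
    (hd : ∀ i j, i ≠ j → (path i).Disjoint (path j)) :
    ((1 - G.lambdaMatrix)⁻¹.submatrix v t).det ≠ 0 := by
  obtain ⟨r, hr⟩ := hG.exists_flowRank ∅
  refine det_submatrix_ne_zero_of_paths (O := Set.range FlowNode.obs)
    (fun v w h => hr v w (auxFlowEdge_of_rightLabel h)) rightLabel_injective ?_ ?_ hp hd
    (flowRows 0 0 ((1 - G.lambdaMatrix)⁻¹.submatrix id t)) ?_
  · intro v w h
    obtain ⟨x, rfl, rfl⟩ := rightLabel_eq_some_none h
    simp
  · intro v w w' h h'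
    obtain ⟨x, rfl, rfl⟩ := rightLabel_eq_some_none h
    obtain ⟨x', hx, rfl⟩ := rightLabel_eq_some_none h'
    rw [FlowNode.obs.inj hx]
  · rw [labelWeight_rightLabel, one_sub_flowWeight_mul, unitColumns_sink]
    congr 1
    · simp
    · simp
    · rw [← mul_unitColumns, ← Matrix.mul_assoc, ← Matrix.sub_mul]
      nth_rewrite 1 [← Matrix.one_mul (1 - G.lambdaMatrix)⁻¹]
      rw [← Matrix.sub_mul, hG.mul_inv, Matrix.one_mul]

theorem map_inv_eq_map_inv {R S : Type*} [CommRing R] [CommRing S] {A : Matrix V V R}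
    (hA : IsUnit A.det) (f g : R →+* S) (h : A.map f = A.map g) : A⁻¹.map f = A⁻¹.map g := by
  have h1 : A⁻¹.map f * A.map f = 1 := by
    rw [← Matrix.map_mul, Matrix.nonsing_inv_mul _ hA, Matrix.map_one _ (map_zero f) (map_one f)]
  have h2 : A.map g * A⁻¹.map g = 1 := by
    rw [← Matrix.map_mul, Matrix.mul_nonsing_inv _ hA, Matrix.map_one _ (map_zero g) (map_one g)]
  rw [h] at h1
  exact left_inv_eq_right_inv h1 h2

theorem gramSpecialization_inv (hG : G.IsAcyclic) {k : ℕ}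
    (C : Matrix V (Fin k) (Polynomial G.ParamRing)) :
    (1 - G.lambdaMatrix)⁻¹.map (G.gramSpecialization C) =
      (1 - G.lambdaMatrix)⁻¹.map (Polynomial.C : G.ParamRing →+* _) := by
  refine map_inv_eq_map_inv (by simp [hG.det_one_sub_lambdaMatrix]) _ _ ?_
  rw [Matrix.map_sub _ (map_sub _), Matrix.map_sub _ (map_sub _), Matrix.map_one _ (map_zero _)
    (map_one _), Matrix.map_one _ (map_zero _) (map_one _)]
  congr 1
  ext u v : 1
  exact gramSpecialization_lambdaMatrix C u v

theorem gramSpecialization_leftFlow (hG : G.IsAcyclic) (K : Set G.DirEdge) {k : ℕ}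
    (C : Matrix V (Fin k) (Polynomial G.ParamRing)) :
    (G.leftFlow K).map (G.gramSpecialization C) =
      (G.leftFlow K).map (Polynomial.C : G.ParamRing →+* _) := by
  have h : (1 - G.knownParamLambda K).map (G.gramSpecialization C) =
      (1 - G.knownParamLambda K).map (Polynomial.C : G.ParamRing →+* _) := by
    rw [Matrix.map_sub _ (map_sub _), Matrix.map_sub _ (map_sub _), Matrix.map_one _ (map_zero _)
      (map_one _), Matrix.map_one _ (map_zero _) (map_one _)]
    congr 1
    ext u v : 1
    rw [map_apply, map_apply, knownParamLambda_apply]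
    split_ifs
    · exact gramSpecialization_lambdaMatrix C u v
    · simp
  rw [leftFlow, flowRows_map, flowRows_map, Matrix.map_mul, Matrix.map_mul, transpose_map,
    transpose_map, transpose_map, transpose_map, h, gramSpecialization_inv hG]
  congr 1
  ext u v : 1
  simp

/-- The determinant of the matrix `A` does not vanish on the graph of the parametrization if the
flow graph has a flow of full size. -/
theorem det_flowCovariance_ne_zero (hG : G.IsAcyclic) {K : Set G.DirEdge} {k : ℕ}
    {src : Fin k → Source V} {tgt : Fin k → V}
    (h : HasFullFlow (G.AuxFlowEdge K) (fun i => (src i).node) (fun j => FlowNode.sink (tgt j))) :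
    ((G.flowCovariance K).submatrix (fun i => (src i).node) tgt).det ≠ 0 := by
  obtain ⟨π, path, hp, hd⟩ := h
  have hsplit : ∀ i, ∃ (L M : List (FlowNode V)) (u v : V), path i = L ++ M ∧
        L.IsChain (fun x y => G.leftLabel K x y ≠ none) ∧ L.head? = some (src i).node ∧
        L.getLast? = some (.aux u) ∧ M.IsChain (fun x y => G.rightLabel x y ≠ none) ∧
        M.head? = some (.sink v) ∧ M.getLast? = some (.sink (tgt (π i))) ∧
        (u = v ∨ G.bi.Adj u v) := by
    intro i
    rcases exists_path_split (hp i).1 (hp i).2.1 (hp i).2.2 with ⟨⟨w, hw⟩, -⟩ | ⟨-, h⟩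
    · dsimp only at hw
      rcases hs : src i with v | v <;> rw [hs] at hw <;> cases hw
    · exact h
  choose L M u v hLM hL hLh hLl hM hMh hMl huv using hsplit
  have hleft := det_leftFlow_ne_zero hG (src := fun i => (src i).node)
    (fun i => ⟨hL i, hLh i, hLl i⟩) fun i j hij x hi hj =>
      hd i j hij (a := x) (by rw [hLM]; simp [hi]) (by rw [hLM]; simp [hj])
  have hright := det_inv_submatrix_ne_zero hG (t := fun i => tgt (π i))
    (fun i => ⟨hM i, hMh i, hMl i⟩) fun i j hij x hi hj =>
      hd i j hij (a := x) (by rw [hLM]; simp [hi]) (by rw [hLM]; simp [hj])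
  -- Column `i` is supported on `u i` and `v i`, which are equal or joined by a bidirected edge, so
  -- `C * Cᵀ` respects the zeros of $\Omega$. At $t=0$ it selects the nodes `u`, at $t=1$ the nodes
  -- `v`.
  let C : Matrix V (Fin k) (Polynomial G.ParamRing) :=
    (1 - Polynomial.X : Polynomial G.ParamRing) • unitColumns _ u +
      (Polynomial.X : Polynomial G.ParamRing) • unitColumns _ v
  have hC : ∀ a b, a ≠ b → ¬ G.bi.Adj a b → (C * Cᵀ) a b = 0 := by
    intro a b hab hadj
    rw [Matrix.mul_apply]
    refine Finset.sum_eq_zero fun i _ => ?_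
    have hsupp : ∀ a, C a i ≠ 0 → a = u i ∨ a = v i := by
      intro a ha
      by_contra hn
      rw [not_or] at hn
      exact ha (by simp [C, unitColumns, hn.1, hn.2])
    by_contra hne
    rw [transpose_apply] at hne
    have ha := hsupp a (left_ne_zero_of_mul hne)
    have hb := hsupp b (right_ne_zero_of_mul hne)
    rcases huv i with h | h
    · rw [← h, or_self] at ha hb
      exact hab (ha.trans hb.symm)
    · rcases ha with rfl | rfl <;> rcases hb with rfl | rfl
      · exact hab rfl
      · exact hadj h
      · exact hadj h.symm
      · exact hab rfl
  have hC0 : C.map (Polynomial.evalRingHom (0 : G.ParamRing)) = unitColumns _ u := by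
    ext a i : 1
    simp only [C, unitColumns, map_apply, Matrix.add_apply, Matrix.smul_apply, smul_eq_mul]
    split_ifs <;> simp
  have hC1 : C.map (Polynomial.evalRingHom (1 : G.ParamRing)) = unitColumns _ v := by
    ext a i : 1
    simp only [C, unitColumns, map_apply, Matrix.add_apply, Matrix.smul_apply, smul_eq_mul]
    split_ifs <;> simp
  set F := (G.leftFlow K).submatrix (fun i => (src i).node) id with hF
  set H := (1 - G.lambdaMatrix)⁻¹.submatrix id (fun i => tgt (π i)) with hH
  have h1 : (F.map (Polynomial.C : G.ParamRing →+* _) * C).det ≠ 0 := by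
    intro h0
    apply hleft
    have := congrArg (Polynomial.evalRingHom (0 : G.ParamRing)) h0
    rw [RingHom.map_det, RingHom.mapMatrix_apply, Matrix.map_mul, hC0, map_C_map_evalRingHom, mul_unitColumns,
      map_zero] at this
    exact this
  have h2 : (Cᵀ * H.map (Polynomial.C : G.ParamRing →+* _)).det ≠ 0 := by
    intro h0
    apply hright
    have := congrArg (Polynomial.evalRingHom (1 : G.ParamRing)) h0
    rw [RingHom.map_det, RingHom.mapMatrix_apply, Matrix.map_mul, transpose_map, hC1, map_C_map_evalRingHom,
      unitColumns_transpose_mul, map_zero] at this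
    exact this
  -- Both factors are square of size `k`, so the determinant is a product of two nonzero elements of
  -- a domain.
  have hfact : ((G.flowCovariance K).submatrix (fun i => (src i).node) fun i => tgt (π i)).map
      (G.gramSpecialization C) = (F.map (Polynomial.C : G.ParamRing →+* _) * C) *
        (Cᵀ * H.map (Polynomial.C : G.ParamRing →+* _)) := by
    have : (G.flowCovariance K).map (G.gramSpecialization C) =
        ((G.leftFlow K).map (Polynomial.C : G.ParamRing →+* _) * C) *
          (Cᵀ * (1 - G.lambdaMatrix)⁻¹.map (Polynomial.C : G.ParamRing →+* _)) := by
      rw [flowCovariance_eq_leftFlow, Matrix.map_mul, Matrix.map_mul,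
        gramSpecialization_omegaMatrix hC, gramSpecialization_leftFlow hG,
        gramSpecialization_inv hG]
      simp only [Matrix.mul_assoc]
    ext i j : 1
    exact congrFun (congrFun this (src i).node) (tgt (π j))
  intro h0
  have h3 : ((G.flowCovariance K).submatrix (fun i => (src i).node) fun i => tgt (π i)).det = 0 := by
    have := det_permute' π ((G.flowCovariance K).submatrix (fun i => (src i).node) tgt)
    rw [h0, mul_zero] at this
    exact this
  have h4 := congrArg (G.gramSpecialization C) h3
  rw [RingHom.map_det, RingHom.mapMatrix_apply, hfact, det_mul, map_zero] at h4
  exact mul_ne_zero h1 h2 h4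

end MixedGraph

namespace MixedGraph

open Matrix

variable {V : Type*} {G : MixedGraph V}

/-! ### Orders of identification -/

/-- The edge can be identified in at most `n + 1` rounds. -/
inductive ICIdentifiedAt (G : MixedGraph V) : ℕ → G.DirEdge → Prop
  | step (n : ℕ) (K : Set G.DirEdge) (e : G.DirEdge) (c : CutsetData V) (m : G.DirEdge → ℕ)
      (hm : ∀ f ∈ K, m f < n) (hK : ∀ f ∈ K, ICIdentifiedAt G (m f) f)
      (hc : G.IsInstrumentalCutset K e c) : ICIdentifiedAt G n e

theorem ICIdentified.exists_identifiedAt [Finite V] {e : G.DirEdge} (h : G.ICIdentified e) :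
    ∃ n, G.ICIdentifiedAt n e := by
  classical
  induction h with
  | step K e c _ hc ih =>
    choose! m hm using ih
    obtain ⟨B, hB⟩ := (Set.finite_range m).bddAbove
    exact ⟨B + 1, .step _ K e c m (fun f _ => Nat.lt_succ_of_le (hB ⟨f, rfl⟩)) hm hc⟩

/-- The rank is the least round bound. The last step of a derivation attaining it uses only edges
with smaller bounds, hence of smaller rank. -/
theorem IsICIdentifiable.exists_rank [Finite V] (hIC : G.IsICIdentifiable) :
    ∃ h : G.DirEdge → ℕ, ∀ e, ∃ (K : Set G.DirEdge) (c : CutsetData V),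
      (∀ f ∈ K, h f < h e) ∧ G.IsInstrumentalCutset K e c := by
  classical
  have hex : ∀ e, ∃ n, G.ICIdentifiedAt n e := fun e => (hIC e).exists_identifiedAt
  refine ⟨fun e => Nat.find (hex e), fun e => ?_⟩
  generalize hn : Nat.find (hex e) = n
  have h := Nat.find_spec (hex e)
  rw [hn] at h
  obtain ⟨_, K, _, c, m, hm, hK, hc⟩ := h
  refine ⟨K, c, fun f hf => ?_, hc⟩
  change Nat.find (hex f) < Nat.find (hex _)
  rw [hn]
  exact (Nat.find_le (hK f hf)).trans_lt (hm f hf)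

theorem exists_linearOrder_of_rank {α : Type*} [Finite α] (h : α → ℕ) :
    ∃ r : LinearOrder α, ∀ a b, h a < h b → r.lt a b := by
  obtain ⟨n, ⟨i⟩⟩ := Finite.exists_equiv_fin α
  -- Ties in rank are broken by an arbitrary enumeration.
  let f : α → ℕ ×ₗ Fin n := fun a => toLex (h a, i a)
  have hf : Function.Injective f := fun a b hab => by
    have := congrArg (fun p => (ofLex p).2) hab
    exact i.injective this
  refine ⟨LinearOrder.lift' f hf, fun a b hab => ?_⟩
  change f a < f b
  exact Prod.Lex.toLex_lt_toLex.2 (.inl hab)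

/-! ### Degrees -/

theorem totalDegree_det_le {σ n : Type*} [Fintype n] [DecidableEq n]
    (M : Matrix n n (MvPolynomial σ ℝ)) (d : n → ℕ) (h : ∀ i j, (M i j).totalDegree ≤ d j) :
    M.det.totalDegree ≤ ∑ j, d j := by
  rw [det_apply']
  refine MvPolynomial.totalDegree_finsetSum_le fun σ _ => ?_
  refine (MvPolynomial.totalDegree_mul _ _).trans ?_
  rw [← map_intCast (MvPolynomial.C : ℝ →+* _), MvPolynomial.totalDegree_C, zero_add]
  exact (MvPolynomial.totalDegree_finsetProd _ _).trans (Finset.sum_le_sum fun j _ => h _ _)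

theorem totalDegree_mul_apply_le {σ l m n : Type*} [Fintype m]
    {M : Matrix l m (MvPolynomial σ ℝ)} {N : Matrix m n (MvPolynomial σ ℝ)} {a b : ℕ}
    (hM : ∀ i j, (M i j).totalDegree ≤ a) (hN : ∀ i j, (N i j).totalDegree ≤ b) (i : l) (j : n) :
    ((M * N) i j).totalDegree ≤ a + b := by
  rw [Matrix.mul_apply]
  exact MvPolynomial.totalDegree_finsetSum_le fun p _ =>
    (MvPolynomial.totalDegree_mul _ _).trans (add_le_add (hM _ _) (hN _ _))

theorem det_mem_subalgebra {R A n : Type*} [CommRing R] [CommRing A] [Algebra R A] [Fintype n]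
    [DecidableEq n] (S : Subalgebra R A) {M : Matrix n n A} (h : ∀ i j, M i j ∈ S) :
    M.det ∈ S := by
  rw [det_apply']
  exact S.sum_mem fun σ _ => S.mul_mem (intCast_mem S _) (S.prod_mem fun i _ => h _ _)

theorem mul_apply_mem_subalgebra {R A l m n : Type*} [CommRing R] [CommRing A] [Algebra R A]
    [Fintype m] {S : Subalgebra R A} {M : Matrix l m A} {N : Matrix m n A}
    (hM : ∀ i j, M i j ∈ S) (hN : ∀ i j, N i j ∈ S) (i : l) (j : n) : (M * N) i j ∈ S :=
  S.sum_mem fun p _ => S.mul_mem (hM i p) (hN p j)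

theorem totalDegree_sigmaMatrix_le (u v : V) : (G.sigmaMatrix u v).totalDegree ≤ 1 := by
  rw [sigmaMatrix, MvPolynomial.totalDegree_X]

theorem sigmaMatrix_mem (known : Set G.Param) (u v : V) :
    G.sigmaMatrix u v ∈ G.knownRing known :=
  MvPolynomial.X_mem_supported.2 (.inr ⟨_, rfl⟩)

theorem totalDegree_one_sub_knownLambda_le [DecidableEq V] (K : Set G.DirEdge) (u v : V) :
    ((1 - G.knownLambda K) u v).totalDegree ≤ 1 := by
  rw [Matrix.sub_apply]
  refine (MvPolynomial.totalDegree_sub _ _).trans (max_le ?_ ?_)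
  · rw [Matrix.one_apply]
    split_ifs <;> simp
  · rw [knownLambda]
    split_ifs <;> simp

theorem one_sub_knownLambda_mem [DecidableEq V] {K : Set G.DirEdge} {known : Set G.Param}
    (hK : ∀ f ∈ K, Sum.inl f ∈ known) (u v : V) :
    (1 - G.knownLambda K) u v ∈ G.knownRing known := by
  rw [Matrix.sub_apply]
  refine sub_mem ?_ ?_
  · rw [Matrix.one_apply]
    split_ifs
    · exact one_mem _
    · exact zero_mem _
  · rw [knownLambda]
    split_ifs with h
    · exact MvPolynomial.X_mem_supported.2 (.inl ⟨_, hK _ h.choose_spec, rfl⟩)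
    · exact zero_mem _

theorem IsInstrumentalCutset.card_le [Finite V] {K : Set G.DirEdge} {e : G.DirEdge} {c : CutsetData V}
    (hc : G.IsInstrumentalCutset K e c) : c.k ≤ (G.parents e.1.2).ncard := by
  have h := Set.ncard_le_ncard (s := Set.range c.tgt) (t := G.parents e.1.2)
    (by rintro _ ⟨j, rfl⟩; exact hc.tgt_parent j) (Set.toFinite _)
  rwa [← Set.image_univ, Set.ncard_image_of_injective _ hc.tgt_injective, Set.ncard_univ,
    Nat.card_fin] at h

variable [Fintype V] [DecidableEq V]

theorem totalDegree_cutsetMatrix_le (K : Set G.DirEdge) (c : CutsetData V) (i j : Fin c.k) :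
    (G.cutsetMatrix K c i j).totalDegree ≤ 2 := by
  rw [cutsetMatrix]
  rcases c.src i with v | v
  · exact (totalDegree_sigmaMatrix_le _ _).trans one_le_two
  · exact totalDegree_mul_apply_le (a := 1) (b := 1)
      (fun u v => totalDegree_one_sub_knownLambda_le K v u) totalDegree_sigmaMatrix_le _ _

theorem totalDegree_cutsetVector_le (K : Set G.DirEdge) (y : V) (c : CutsetData V) (i : Fin c.k) :
    (G.cutsetVector K y c i).totalDegree ≤ 3 := by
  rw [cutsetVector]
  rcases c.src i with v | v
  · exact (totalDegree_mul_apply_le (a := 1) (b := 1) totalDegree_sigmaMatrix_le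
      (totalDegree_one_sub_knownLambda_le K) _ _).trans (by norm_num)
  · exact totalDegree_mul_apply_le (a := 2) (b := 1)
      (fun i j => totalDegree_mul_apply_le (a := 1) (b := 1)
        (fun u v => totalDegree_one_sub_knownLambda_le K v u) totalDegree_sigmaMatrix_le i j)
      (totalDegree_one_sub_knownLambda_le K) _ _

theorem cutsetMatrix_mem {K : Set G.DirEdge} {known : Set G.Param}
    (hK : ∀ f ∈ K, Sum.inl f ∈ known) (c : CutsetData V) (i j : Fin c.k) :
    G.cutsetMatrix K c i j ∈ G.knownRing known := by
  rw [cutsetMatrix]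
  rcases c.src i with v | v
  · exact sigmaMatrix_mem _ _ _
  · exact mul_apply_mem_subalgebra (fun u v => one_sub_knownLambda_mem hK v u)
      (sigmaMatrix_mem _) _ _

theorem cutsetVector_mem {K : Set G.DirEdge} {known : Set G.Param}
    (hK : ∀ f ∈ K, Sum.inl f ∈ known) (y : V) (c : CutsetData V) (i : Fin c.k) :
    G.cutsetVector K y c i ∈ G.knownRing known := by
  rw [cutsetVector]
  rcases c.src i with v | v
  · exact mul_apply_mem_subalgebra (sigmaMatrix_mem _) (one_sub_knownLambda_mem hK) _ _
  · exact mul_apply_mem_subalgebra (mul_apply_mem_subalgebra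
      (fun u v => one_sub_knownLambda_mem hK v u) (sigmaMatrix_mem _))
      (one_sub_knownLambda_mem hK) _ _

theorem totalDegree_cutsetPolynomial_le (K : Set G.DirEdge) (e : G.DirEdge) (c : CutsetData V) :
    (G.cutsetPolynomial K e c).totalDegree ≤ 2 * c.k + 1 := by
  rw [cutsetPolynomial]
  refine (MvPolynomial.totalDegree_sub _ _).trans (max_le ?_ ?_)
  · refine (MvPolynomial.totalDegree_mul _ _).trans ?_
    rw [MvPolynomial.totalDegree_X, add_comm]
    have := totalDegree_det_le (G.cutsetMatrix K c) (fun _ => 2) (totalDegree_cutsetMatrix_le K c)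
    simp only [Finset.sum_const, Finset.card_univ, Fintype.card_fin, smul_eq_mul] at this
    omega
  -- The column `b` has degree at most 3, one more than the other columns, which matches the factor
  -- $\lambda_{xy}$ in the first term.
  · refine (totalDegree_det_le _ (fun j => 2 + if j = c.col then 1 else 0) fun i j => ?_).trans ?_
    · by_cases hj : j = c.col
      · subst hj
        rw [updateCol_self, if_pos rfl]
        exact totalDegree_cutsetVector_le K _ c i
      · rw [updateCol_ne hj, if_neg hj]
        exact totalDegree_cutsetMatrix_le K c i j
    · rw [Finset.sum_add_distrib, Finset.sum_ite_eq']
      simp [mul_comm]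

/-! ### Identifying polynomials -/

theorem isIdentifyingPolynomial_cutsetPolynomial (hG : G.IsAcyclic) {r : LinearOrder G.Param}
    {K : Set G.DirEdge} {e : G.DirEdge} {c : CutsetData V}
    (hK : ∀ f ∈ K, r.lt (Sum.inl f) (Sum.inl e)) (hc : G.IsInstrumentalCutset K e c) :
    G.IsIdentifyingPolynomial r (Sum.inl e) (G.cutsetPolynomial K e c) := by
  have hmem : ∀ f ∈ K, (Sum.inl f : G.Param) ∈ (Sum.inl '' K : Set G.Param) :=
    fun f hf => ⟨f, hf, rfl⟩
  refine ⟨(G.mem_graphIdeal_iff _).2 (covarianceHom_cutsetPolynomial hG hc), Sum.inl '' K, ?_,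
    _, det_mem_subalgebra _ (cutsetMatrix_mem hmem c), _, det_mem_subalgebra _ fun i j => ?_, ?_,
    rfl⟩
  · rintro _ ⟨f, hf, rfl⟩
    exact hK f hf
  · by_cases hj : j = c.col
    · subst hj
      rw [updateCol_self]
      exact cutsetVector_mem hmem _ c i
    · rw [updateCol_ne hj]
      exact cutsetMatrix_mem hmem c i j
  · rw [mem_graphIdeal_iff, AlgHom.map_det, AlgHom.mapMatrix_apply, cutsetMatrix_map]
    exact det_flowCovariance_ne_zero hG hc.flow

theorem isIdentifyingPolynomial_sub {r : LinearOrder G.Param} {q : G.Param} {b : G.FullRing}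
    {known : Set G.Param} (hknown : ∀ t ∈ known, r.lt t q) (hb : b ∈ G.knownRing known)
    (hval : G.covarianceHom b = MvPolynomial.X q) :
    G.IsIdentifyingPolynomial r q (MvPolynomial.X (Sum.inl q) - b) := by
  refine ⟨?_, known, hknown, 1, one_mem _, b, hb, ?_, ?_⟩
  · rw [mem_graphIdeal_iff, map_sub, covarianceHom_X_inl, hval, sub_self]
  · rw [mem_graphIdeal_iff, map_one]
    exact one_ne_zero
  · rw [mul_one]

/-- Once all of $\Lambda$ is known, $\omega_{uv}=[(I-\Lambda)^\top\Sigma(I-\Lambda)]_{uv}$ modulo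
the ideal, an expression of degree at most 3. -/
theorem exists_identifyingPolynomial_bidirected (hG : G.IsAcyclic) {r : LinearOrder G.Param}
    (z : G.BiIndex) (hr : ∀ f : G.DirEdge, r.lt (Sum.inl f) (Sum.inr z)) :
    ∃ g, G.IsIdentifyingPolynomial r (Sum.inr z) g ∧ g.totalDegree ≤ 3 := by
  obtain ⟨z, hz⟩ := z
  induction z using Sym2.ind with
  | _ u v =>
    have hmem : ∀ f ∈ (Set.univ : Set G.DirEdge),
        (Sum.inl f : G.Param) ∈ (Set.range Sum.inl : Set G.Param) := fun f _ => ⟨f, rfl⟩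
    let N : Matrix V V G.FullRing := 1 - G.knownLambda Set.univ
    have hN : N.map G.covarianceHom = 1 - G.lambdaMatrix := by
      rw [map_one_sub_knownLambda]
      congr 1
      ext a b : 1
      rw [knownParamLambda_apply]
      by_cases h : G.dir a b
      · rw [if_pos ⟨h, trivial⟩]
      · rw [if_neg (fun h' => h h'.choose), lambdaMatrix, dif_neg h]
    have hB : (Nᵀ * G.sigmaMatrix * N).map G.covarianceHom = G.omegaMatrix := by
      rw [Matrix.map_mul, Matrix.map_mul, transpose_map, hN, sigmaMatrix_map, covariance,
        Matrix.mul_assoc, Matrix.mul_assoc _ _ (1 - G.lambdaMatrix), hG.inv_mul, Matrix.mul_one,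
        ← Matrix.mul_assoc, ← transpose_mul, hG.inv_mul, transpose_one, Matrix.one_mul]
    have hdeg : ((Nᵀ * G.sigmaMatrix * N : Matrix V V G.FullRing) u v).totalDegree ≤ 3 :=
      totalDegree_mul_apply_le (a := 2) (b := 1)
        (fun i j => totalDegree_mul_apply_le (a := 1) (b := 1)
          (fun u v => totalDegree_one_sub_knownLambda_le _ v u) totalDegree_sigmaMatrix_le i j)
        (totalDegree_one_sub_knownLambda_le _) _ _
    have hmemB : (Nᵀ * G.sigmaMatrix * N : Matrix V V G.FullRing) u v ∈
        G.knownRing (Set.range Sum.inl) :=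
      mul_apply_mem_subalgebra (mul_apply_mem_subalgebra
        (fun u v => one_sub_knownLambda_mem hmem v u) (sigmaMatrix_mem _))
        (one_sub_knownLambda_mem hmem) _ _
    have hval : G.covarianceHom ((Nᵀ * G.sigmaMatrix * N : Matrix V V G.FullRing) u v) =
        MvPolynomial.X (Sum.inr ⟨s(u, v), hz⟩) := by
      have h := congrFun (congrFun hB u) v
      rwa [map_apply, omegaMatrix, dif_pos hz] at h
    generalize (Nᵀ * G.sigmaMatrix * N : Matrix V V G.FullRing) u v = b at hdeg hmemB hval
    refine ⟨_, isIdentifyingPolynomial_sub ?_ hmemB hval, ?_⟩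
    · rintro _ ⟨f, rfl⟩
      exact hr f
    · refine (MvPolynomial.totalDegree_sub _ _).trans (max_le ?_ hdeg)
      rw [MvPolynomial.totalDegree_X]
      norm_num

end MixedGraph

theorem mainTheorem5 {V : Type*} [Fintype V] [DecidableEq V] (G : MixedGraph V)
    (hG : G.IsAcyclic) (hIC : G.IsICIdentifiable)
    (s : ℕ) (hs : 1 ≤ s) (hpa : ∀ v, (G.parents v).ncard ≤ s) :
    ∃ r : LinearOrder G.Param, G.IsIdentifyingOrder r ∧
      ∃ P : G.Param → G.FullRing,
        (∀ q, G.IsIdentifyingPolynomial r q (P q)) ∧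
        (∀ q, (P q).totalDegree ≤ 2 * s + 1) ∧
        ∀ e : G.DirEdge, ∃ (K : Set G.DirEdge) (c : MixedGraph.CutsetData V),
          (∀ f ∈ K, r.lt (Sum.inl f) (Sum.inl e)) ∧
          G.IsInstrumentalCutset K e c ∧
          P (Sum.inl e) = G.cutsetPolynomial K e c := by
  obtain ⟨h, hh⟩ := hIC.exists_rank
  obtain ⟨B, hB⟩ := (Set.finite_range h).bddAbove
  -- The value `B + 1` exceeds every edge rank and so places all $\omega$ after all $\lambda$.
  obtain ⟨r, hr⟩ := MixedGraph.exists_linearOrder_of_rank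
    (Sum.elim h fun _ => B + 1 : G.Param → ℕ)
  choose K c hK hc using hh
  have hKr : ∀ e, ∀ f ∈ K e, r.lt (Sum.inl f) (Sum.inl e) := fun e f hf => hr _ _ (hK e f hf)
  have hω : ∀ z : G.BiIndex, ∃ g, G.IsIdentifyingPolynomial r (Sum.inr z) g ∧
      g.totalDegree ≤ 3 := fun z => MixedGraph.exists_identifyingPolynomial_bidirected hG z
    fun f => hr _ _ (Nat.lt_succ_of_le (hB ⟨f, rfl⟩))
  choose g hg hgd using hω
  let P : G.Param → G.FullRing := Sum.elim (fun e => G.cutsetPolynomial (K e) e (c e)) g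
  have hP : ∀ q, G.IsIdentifyingPolynomial r q (P q) := by
    rintro (e | z)
    · exact MixedGraph.isIdentifyingPolynomial_cutsetPolynomial hG (hKr e) (hc e)
    · exact hg z
  refine ⟨r, fun q => ⟨P q, hP q⟩, P, hP, ?_, fun e => ⟨K e, c e, hKr e, hc e, rfl⟩⟩
  rintro (e | z)
  · refine (MixedGraph.totalDegree_cutsetPolynomial_le (K e) e (c e)).trans ?_
    have := (hc e).card_le.trans (hpa e.1.2)
    omega
  -- Here $3\le 2s+1$, which needs $s\ge 1$.
  · refine (hgd z).trans ?_
    omega
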